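/- Let $G=(V,E)$ be a finite simple bipartite graph with maximum degree $\Delta$, and let $k\ge\Delta$. An edge $k$-coloring of $G$ is a map $C:E\to\{1,\dots,k\}$ giving different colors to adjacent edges. For an arbitrary map $C:E\to\{1,\dots,k\}$, a vertex $v$ has a $(+c-c')$-deficiency if exactly two edges at $v$ have color $c$, the remaining edges at $v$ have pairwise different colors different from $c$, and no edge at $v$ has color $c'$; $v$ is deficient if it has some deficiency, and the edges at $v$ of its repeated color $c$ are then called the repeated edges of $v$. Flipping a set of edges with respect to two colors $a,b$ means interchanging $a$ and $b$ on these edges. An alternating trail with colors $a,b$ is a trail whose edges are alternately colored $a$ and $b$. The maximal alternating path or cycle with colors $a,b$ through an edge $e$ is the alternating cycle through $e$ if there is one, and otherwise an alternating trail containing $e$ that cannot be extended at either end (chosen uniformly if there are several candidates). The Markov chain $M(G,k)$ on the set of edge $k$-colorings of $G$ makes the following step from the current coloring $C$. All selections are uniform, and a selection from an empty set means that the part of the step that depends on it is omitted. (1) With probability $\frac12$, do nothing. (2) With probability $\frac14$, select an unordered pair $\{c,c'\}$ of colors and let $H$ be the subgraph of the edges of colors $c,c'$. An end vertex of $H$ is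 a vertex of degree one in $H$; sub-paths have at least one edge. With probability $\frac13$ each: (a) select nothing; (b) select one of all the sub-paths and cycles of $H$; (c) select one of all the unordered pairs of distinct sub-paths of $H$ such that each of the two has exactly one end vertex that is an end vertex of $H$. Flip the selected edges (with respect to $c,c'$). If there is now a deficient vertex, select a deficient vertex and one of its repeated edges, and change the color of this edge from $c$ to $c'$ or from $c'$ to $c$. Otherwise, with probability $\frac12$ select any edge of color $c$ or $c'$ and change its color to the other of the two, and with probability $\frac12$ do nothing. Finally eliminate all deficiencies with the colors $K=\{c,c'\}$. (3) With probability $\frac14$, select three distinct colors and a distinguished one $c''$ among them; let $c,c'$ be the other two and let $H$ be the subgraph of the edges of colors $c,c'$. With probability $\frac13$ each: (a) select nothing; (b) select one of the sub-paths of $H$ at least one of whose end vertices is not an end vertex of $H$; (c) select a pair of sub-paths as in (2)(c). Flip the selected edges (with respect to $c,c'$). If there are two deficient vertices, select one of them; if there is exactly one, then with probability $\frac12$ select it and with probability $\frac12$ select a non-deficient vertex incident to an edge of color $c''$ and to an edge of color $c$ or $c'$; if there is none, select such a non-deficient vertex. If a deficient vertex was selected, select one of its repeated edges, of color $\tilde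 c$ say, and flip the maximal alternating path or cycle with colors $\tilde c,c''$ through this edge. If a non-deficient vertex $v$ was selected, let $e$ be its edge of color $c''$, select an edge $f$ at $v$ of color $\tilde c\in\{c,c'\}$, and flip the maximal alternating path with colors $c'',\tilde c$ that contains $e$ but not $f$. Finally eliminate all deficiencies with the colors $K=\{c,c',c''\}$. Eliminating all deficiencies with the colors $K$ means: as long as there is a deficient vertex, select a deficient vertex $v$, select one of its repeated edges and a color $b\in K$ missing at $v$, and flip the maximal alternating path through this edge with the repeated color and $b$. (This ends after at most $|V|$ rounds in an edge $k$-coloring, the new state.) Theorem. Let $P$ be the transition matrix of $M(G,k)$. For any two edge $k$-colorings $C_1,C_2$ of $G$ there is an $n\le 6|E|$ with $(P^n)_{C_1,C_2}>0$; that is, $C_1$ can be transformed into $C_2$ in at most $6|E|$ steps of $M(G,k)$. Consequently $M(G,k)$ is irreducible, and its diameter (the maximum over pairs of states of the least number of steps that leads from one to the other with positive probability) is at most $6|E|$. -/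

import Mathlib

noncomputable section

open scoped Classical

namespace BipartiteEdgeColoring

/-! ## Finite random choices -/

/-- Choose an element of the finite set `s` uniformly and continue with `f`;
if `s` is empty, continue with `d`. -/
def pick {α β : Type*} (s : Finset α) (f : α → PMF β) (d : PMF β) : PMF β :=
  if h : s.Nonempty then (PMF.uniformOfFinset s h).bind f else d

/-- A fair coin: continue with `x` with probability `1/2` and with `y` with probability `1/2`. -/
def coin {β : Type*} (x y : PMF β) : PMF β :=
  (PMF.uniformOfFintype Bool).bind fun t => if t then x else y

/-- Continue with each of `x`, `y`, `z` with probability `1/3`. -/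
def threeWay {β : Type*} (x y z : PMF β) : PMF β :=
  (PMF.uniformOfFintype (Fin 3)).bind fun i => if i = 0 then x else if i = 1 then y else z

/-! ## Edge colorings and deficiencies -/

section Colorings

variable {V : Type*} {G : SimpleGraph V} {k : ℕ}

/-- No two adjacent edges have the same color. -/
def IsProper (C : G.EdgeLabeling (Fin k)) : Prop :=
  ∀ e f : G.edgeSet, G.lineGraph.Adj e f → C e ≠ C f

/-- The color classes `a` and `b` swapped on the edges in `S`. -/
def flip (C : G.EdgeLabeling (Fin k)) (a b : Fin k) (S : Finset G.edgeSet) :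
    G.EdgeLabeling (Fin k) :=
  fun e => if e ∈ S then Equiv.swap a b (C e) else C e

/-- The sequence of colors met along a walk. -/
def colorsAlong (C : G.EdgeLabeling (Fin k)) {x y : V} (p : G.Walk x y) : List (Fin k) :=
  p.darts.map fun d => C ⟨d.edge, d.edge_mem⟩

/-- A trail avoiding the edges in `F` whose edges are alternately colored by `a` and `b`. -/
def IsAltTrail (C : G.EdgeLabeling (Fin k)) (a b : Fin k) (F : Finset G.edgeSet) {x y : V}
    (p : G.Walk x y) : Prop :=
  p.IsTrail ∧ (∀ c ∈ colorsAlong C p, c = a ∨ c = b) ∧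
    (colorsAlong C p).IsChain (· ≠ ·) ∧ ∀ f ∈ F, (f : Sym2 V) ∉ p.edges

end Colorings

section Chain

variable {V : Type*} [Fintype V] {G : SimpleGraph V} {k : ℕ}

/-- The edges of color `c` incident to `v`. -/
def edgesAt (C : G.EdgeLabeling (Fin k)) (v : V) (c : Fin k) : Finset G.edgeSet :=
  Finset.univ.filter fun e => v ∈ (e : Sym2 V) ∧ C e = c

/-- The vertex `v` has a `(+c-c')`-deficiency: exactly two incident edges have color `c`, the
other incident edges have different colors, and no incident edge has color `c'`. -/
def HasDeficiency (C : G.EdgeLabeling (Fin k)) (v : V) (c c' : Fin k) : Prop :=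
  (edgesAt C v c).card = 2 ∧ (∀ d, d ≠ c → (edgesAt C v d).card ≤ 1) ∧ edgesAt C v c' = ∅

/-- The set of deficient vertices. -/
def deficient (C : G.EdgeLabeling (Fin k)) : Finset V :=
  Finset.univ.filter fun v => ∃ c c', HasDeficiency C v c c'

/-- The edges at `v` whose color is the repeated color of a deficiency of `v`. -/
def repeatedEdges (C : G.EdgeLabeling (Fin k)) (v : V) : Finset G.edgeSet :=
  Finset.univ.filter fun e => v ∈ (e : Sym2 V) ∧ ∃ c', HasDeficiency C v (C e) c'

/-- The edges of a walk, as a finite set of edges of the graph. -/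
def walkEdges {x y : V} (p : G.Walk x y) : Finset G.edgeSet :=
  Finset.univ.filter fun e => (e : Sym2 V) ∈ p.edges

/-! ## Alternating paths and cycles in the subgraph of two colors -/

/-- `v` is an end vertex (a vertex of degree one) of the subgraph of the colors `a` and `b`. -/
def IsEndVertex (C : G.EdgeLabeling (Fin k)) (a b : Fin k) (v : V) : Prop :=
  (edgesAt C v a ∪ edgesAt C v b).card = 1

/-- `S` is the edge set of a path with at least one edge, with end vertices `x ≠ y`, in the
subgraph of the colors `a` and `b`. -/
def IsSubpath (C : G.EdgeLabeling (Fin k)) (a b : Fin k) (x y : V) (S : Finset G.edgeSet) :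
    Prop :=
  ∃ p : G.Walk x y, p.IsPath ∧ 0 < p.length ∧ IsAltTrail C a b ∅ p ∧ walkEdges p = S

/-- `S` is the edge set of a cycle avoiding `F` whose edges are alternately colored by `a`
and `b`. -/
def IsAltCycle (C : G.EdgeLabeling (Fin k)) (a b : Fin k) (F S : Finset G.edgeSet) : Prop :=
  ∃ (x : V) (p : G.Walk x x), p.IsCycle ∧ IsAltTrail C a b F p ∧
    (colorsAlong C p).head? ≠ (colorsAlong C p).getLast? ∧ walkEdges p = S

/-- `S` is the edge set of an alternating trail with colors `a` and `b` that avoids `F` and that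
cannot be extended at either of its ends. -/
def IsMaxAltTrail (C : G.EdgeLabeling (Fin k)) (a b : Fin k) (F S : Finset G.edgeSet) : Prop :=
  ∃ (x y : V) (p : G.Walk x y), IsAltTrail C a b F p ∧
    (∀ (z : V) (h : G.Adj y z), ¬ IsAltTrail C a b F (p.concat h)) ∧
    (∀ (z : V) (h : G.Adj z x), ¬ IsAltTrail C a b F (SimpleGraph.Walk.cons h p)) ∧
    walkEdges p = S

/-- The maximal alternating paths and cycles, with colors `a` and `b`, that contain `e` and avoid
`F`: the alternating cycles through `e` if there are any, and otherwise the non-extendable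
alternating trails through `e`.  (In a proper coloring there is exactly one; at a deficient vertex
such a trail may pass twice.) -/
def altChains (C : G.EdgeLabeling (Fin k)) (a b : Fin k) (F : Finset G.edgeSet)
    (e : G.edgeSet) : Finset (Finset G.edgeSet) :=
  if ∃ S, e ∈ S ∧ IsAltCycle C a b F S then
    Finset.univ.filter fun S => e ∈ S ∧ IsAltCycle C a b F S
  else
    Finset.univ.filter fun S => e ∈ S ∧ IsMaxAltTrail C a b F S

/-- All sub-paths and cycles of the subgraph `H` of the colors `a` and `b`. -/
def subpathsAndCycles (C : G.EdgeLabeling (Fin k)) (a b : Fin k) :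
    Finset (Finset G.edgeSet) :=
  Finset.univ.filter fun S => (∃ x y, IsSubpath C a b x y S) ∨ IsAltCycle C a b ∅ S

/-- The sub-paths of `H` at least one of whose end vertices is not an end vertex of `H`. -/
def openSubpaths (C : G.EdgeLabeling (Fin k)) (a b : Fin k) : Finset (Finset G.edgeSet) :=
  Finset.univ.filter fun S => ∃ x y, IsSubpath C a b x y S ∧
    (¬ IsEndVertex C a b x ∨ ¬ IsEndVertex C a b y)

/-- The sub-paths of `H` exactly one of whose end vertices is an end vertex of `H`. -/
def halfOpenSubpaths (C : G.EdgeLabeling (Fin k)) (a b : Fin k) : Finset (Finset G.edgeSet) :=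
  Finset.univ.filter fun S => ∃ x y, IsSubpath C a b x y S ∧
    Xor (IsEndVertex C a b x) (IsEndVertex C a b y)

/-- The unordered pairs of sub-paths of `H`, each with exactly one end vertex that is an end
vertex of `H`. -/
def halfOpenPairs (C : G.EdgeLabeling (Fin k)) (a b : Fin k) :
    Finset (Finset (Finset G.edgeSet)) :=
  (halfOpenSubpaths C a b).powersetCard 2

/-! ## The building blocks of a step -/

/-- With probability `1/3` each: do nothing; flip a uniformly chosen member of `B`; flip the
edges of the two members of a uniformly chosen pair in `halfOpenPairs`. -/
def flipSubpaths (C : G.EdgeLabeling (Fin k)) (a b : Fin k) (B : Finset (Finset G.edgeSet)) :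
    PMF (G.EdgeLabeling (Fin k)) :=
  threeWay (PMF.pure C)
    (pick B (fun S => PMF.pure (flip C a b S)) (PMF.pure C))
    (pick (halfOpenPairs C a b) (fun T => PMF.pure (flip C a b (T.biUnion id))) (PMF.pure C))

/-- At most `n` rounds of the elimination of deficiencies within the set `K` of colors.  In a
round, choose a deficient vertex `v`, one of the two equally colored edges `e` at `v`, and a color
`c' ∈ K` missing at `v`, and flip the maximal alternating path through `e` with the color of `e`
and `c'`. -/
def eliminate (K : Finset (Fin k)) : ℕ → G.EdgeLabeling (Fin k) → PMF (G.EdgeLabeling (Fin k))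
  | 0, C => PMF.pure C
  | n + 1, C =>
    pick (deficient C)
      (fun v =>
        pick (Finset.univ.filter fun o : G.edgeSet × Fin k =>
            v ∈ (o.1 : Sym2 V) ∧ o.2 ∈ K ∧ HasDeficiency C v (C o.1) o.2)
          (fun o =>
            pick (altChains C (C o.1) o.2 ∅ o.1)
              (fun S => eliminate K n (flip C (C o.1) o.2 S))
              (PMF.pure C))
          (PMF.pure C))
      (PMF.pure C)

/-- The change of the color of one edge in a two-color move.  If there is a deficient vertex,
choose one of them and one of its equally colored edges; otherwise, with probability `1/2` choose
any edge of color `a` or `b` and with probability `1/2` do nothing.  The color of the chosen edge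
is changed from `a` to `b` or from `b` to `a`. -/
def recolorEdge (a b : Fin k) (C : G.EdgeLabeling (Fin k)) : PMF (G.EdgeLabeling (Fin k)) :=
  pick (deficient C)
    (fun v => pick (repeatedEdges C v) (fun e => PMF.pure (flip C a b {e})) (PMF.pure C))
    (coin
      (pick (Finset.univ.filter fun e : G.edgeSet => C e = a ∨ C e = b)
        (fun e => PMF.pure (flip C a b {e})) (PMF.pure C))
      (PMF.pure C))

/-- A two-color move with colors `a` and `b`. -/
def twoColorMove (a b : Fin k) (C : G.EdgeLabeling (Fin k)) : PMF (G.EdgeLabeling (Fin k)) :=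
  ((flipSubpaths C a b (subpathsAndCycles C a b)).bind (recolorEdge a b)).bind
    (eliminate {a, b} (Fintype.card V))

/-- Choose a deficient vertex, then one of its equally colored edges `e`, and flip the maximal
alternating path or cycle through `e` with the color of `e` and `d`. -/
def deficientFlip (d : Fin k) (C : G.EdgeLabeling (Fin k)) : PMF (G.EdgeLabeling (Fin k)) :=
  pick (deficient C)
    (fun v => pick (repeatedEdges C v)
      (fun e => pick (altChains C (C e) d ∅ e)
        (fun S => PMF.pure (flip C (C e) d S)) (PMF.pure C))
      (PMF.pure C))
    (PMF.pure C)

/-- Choose a non-deficient vertex `v` incident to an edge `e` of color `d` and to an edge of color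
`a` or `b`; choose such an edge `f` of color `a` or `b` at `v`, and flip the maximal alternating
path with the colors of `e` and `f` that contains `e` but not `f`. -/
def nonDeficientFlip (a b d : Fin k) (C : G.EdgeLabeling (Fin k)) :
    PMF (G.EdgeLabeling (Fin k)) :=
  pick (Finset.univ.filter fun v : V => v ∉ deficient C ∧ (edgesAt C v d).Nonempty ∧
      (edgesAt C v a ∪ edgesAt C v b).Nonempty)
    (fun v => pick (edgesAt C v d)
      (fun e => pick (edgesAt C v a ∪ edgesAt C v b)
        (fun f => pick (altChains C (C f) d {f} e)
          (fun S => PMF.pure (flip C (C f) d S)) (PMF.pure C))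
        (PMF.pure C))
      (PMF.pure C))
    (PMF.pure C)

/-- The middle part of a three-color move: with no deficient vertex flip at a non-deficient
vertex, with one toss a fair coin, with two flip at a deficient vertex. -/
def thirdColorFlip (a b d : Fin k) (C : G.EdgeLabeling (Fin k)) :
    PMF (G.EdgeLabeling (Fin k)) :=
  if (deficient C).card = 0 then nonDeficientFlip a b d C
  else if (deficient C).card = 1 then coin (deficientFlip d C) (nonDeficientFlip a b d C)
  else deficientFlip d C

/-- A three-color move with colors `a` and `b` and distinguished color `d`. -/
def threeColorMove (a b d : Fin k) (C : G.EdgeLabeling (Fin k)) :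
    PMF (G.EdgeLabeling (Fin k)) :=
  ((flipSubpaths C a b (openSubpaths C a b)).bind (thirdColorFlip a b d)).bind
    (eliminate {a, b, d} (Fintype.card V))

/-- One step from the coloring `C`: with probability `1/2` nothing, with probability `1/4` a
two-color move for a uniform unordered pair of colors, and with probability `1/4` a three-color
move for a uniform set of three colors with a uniform distinguished one among them (that is, a
uniform pair of a distinguished color `d` and an unordered pair `a < b` of other colors). -/
def move (C : G.EdgeLabeling (Fin k)) : PMF (G.EdgeLabeling (Fin k)) :=
  coin (PMF.pure C)
    (coin
      (pick (Finset.univ.filter fun c : Fin k × Fin k => c.1 < c.2)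
        (fun c => twoColorMove c.1 c.2 C) (PMF.pure C))
      (pick (Finset.univ.filter fun c : Fin k × Fin k × Fin k =>
          c.1 < c.2.1 ∧ c.2.2 ≠ c.1 ∧ c.2.2 ≠ c.2.1)
        (fun c => threeColorMove c.1 c.2.1 c.2.2 C) (PMF.pure C)))

end Chain

/-! ## The Markov chain -/

section MarkovChain

variable {V : Type*} [Fintype V] (G : SimpleGraph V) (k : ℕ)

/-- The edge `k`-colorings of `G`: the states of the chain. -/
abbrev EdgeColoring : Type _ := {C : G.EdgeLabeling (Fin k) // IsProper C}

instance : Fintype (EdgeColoring G k) := Fintype.ofFinite _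

variable {G k}

/-- One step of the Markov chain on the edge `k`-colorings.  When `G` is bipartite, the
elimination of deficiencies always ends in an edge `k`-coloring, so the second branch, which only
makes the definition total, has probability zero. -/
def step (C : EdgeColoring G k) : PMF (EdgeColoring G k) :=
  (move C.1).map fun D => if h : IsProper D then ⟨D, h⟩ else C

variable (G k)

/-- The transition matrix of the Markov chain `M(G,k)`. -/
def transitionMatrix : Matrix (EdgeColoring G k) (EdgeColoring G k) ℝ :=
  Matrix.of fun C D => (step C D).toReal

end MarkovChain

/-- The least number of steps in which the chain with transition matrix `P` can get from `i` to
`j` with positive probability (`⊤` if there is none). -/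
def stepDistance {S : Type*} [Fintype S] (P : Matrix S S ℝ) (i j : S) : ℕ∞ :=
  ⨅ (n : ℕ) (_ : 0 < (P ^ n) i j), (n : ℕ∞)

/-- The diameter of the chain with transition matrix `P`. -/
def diameter {S : Type*} [Fintype S] (P : Matrix S S ℝ) : ℕ∞ :=
  ⨆ (i : S) (j : S), stepDistance P i j

end BipartiteEdgeColoring

end

/-!
# Irreducibility of a Markov chain on the edge colorings of a bipartite graph

The support of one step contains many moves, and only a few of them are needed.  The route from an
edge coloring to the target `T` treats the colors one after the other and makes each color class
equal to the one of `T`.  On the way it passes through labelings `D` that are not proper: in them,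
on each side of the bipartition, at most one vertex has a `(+a-c)`-deficiency (`OnlyRepeats`).  The
chain itself never visits `D`.  It is at an edge coloring `C` behind which `D` is hidden
(`Resolves`): flipping one or two sub-paths of the colors `a` and `c`, as a step does at its
beginning, turns `C` into `D`.

That every such `D` can be hidden again at the end of a step is
`IsNearProper.exists_resolves`.  For two colors `a` and `b`, orient the edges of color `a` from one
side of the bipartition to the other and those of color `b` the other way round.  The alternating
trails are then the directed trails (`isAltTrail_iff`), the two deficient vertices become a source
and a sink, and counting the edges that enter and leave a vertex shows where a maximal trail can
end.  The maximal trails through the repeated edges are paths; eliminating the deficiencies flips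
one of them, or two disjoint ones, and the next step flips them back.

So the chain can change `D` as follows, one step at a time: a two-color move changes the color
of one repeated edge (`Resolves.exists_move_flip_repeated`), and a three-color move flips an
alternating cycle or trail of the color `a` and a third color `d` at a deficient vertex
(`Resolves.exists_move_third_color`).  In the latter case the trail must not create a new
deficiency.  This holds for one of the two repeated edges: if both trails failed, they would end
with loops at the same vertex, which `IsMaxDirected.false_of_common_end` excludes by counting.

The progress on the color `c` is measured by `excess`, which counts the edges that should have color
`c`, twice the edges that should lose it, and the deficient vertices; `n` steps decrease it by at
least `n` (`OnlyRepeats.exists_progress`, `exists_complete_color`).  At an edge coloring the excess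
is at most the size of the class of `c` in `T` plus twice its size in the current coloring.  Since
all remaining colors together have as many edges in both colorings, some remaining color has a class
that is at most as large as in `T`.  Always choosing such a color gives a total of at most `3 * |E|`
steps (`IsProper.exists_reachesIn`).
-/

noncomputable section

open scoped Classical

namespace BipartiteEdgeColoring

section Basics

/-! ### Supports of the random choices -/

section Supports

variable {α β : Type*}

lemma mem_support_pick {s : Finset α} {f : α → PMF β} {d : PMF β} {x : α} {y : β}
    (hx : x ∈ s) (hy : y ∈ (f x).support) : y ∈ (pick s f d).support := by
  have h : s.Nonempty := ⟨x, hx⟩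
  rw [pick, dif_pos h, PMF.mem_support_bind_iff]
  exact ⟨x, by simpa using hx, hy⟩

lemma mem_support_pick_of_eq_empty {s : Finset α} {f : α → PMF β} {d : PMF β} {y : β}
    (hs : s = ∅) (hy : y ∈ d.support) : y ∈ (pick s f d).support := by
  rwa [pick, dif_neg (by simp [hs])]

lemma mem_support_coin_left {x y : PMF β} {z : β} (h : z ∈ x.support) :
    z ∈ (coin x y).support := by
  rw [coin, PMF.mem_support_bind_iff]
  exact ⟨true, by simp, by simpa using h⟩

lemma mem_support_coin_right {x y : PMF β} {z : β} (h : z ∈ y.support) :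
    z ∈ (coin x y).support := by
  rw [coin, PMF.mem_support_bind_iff]
  exact ⟨false, by simp, by simpa using h⟩

lemma mem_support_threeWay {x y z : PMF β} {w : β} :
    w ∈ (threeWay x y z).support ↔ w ∈ x.support ∨ w ∈ y.support ∨ w ∈ z.support := by
  rw [threeWay, PMF.mem_support_bind_iff]
  constructor
  · rintro ⟨i, -, hi⟩
    fin_cases i <;> simp_all
  · rintro (h | h | h)
    · exact ⟨0, by simp, by simpa using h⟩
    · exact ⟨1, by simp, by simpa using h⟩
    · exact ⟨2, by simp, by simpa using h⟩

end Supports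

variable {V : Type*} {G : SimpleGraph V} {k : ℕ}

/-! ### Flips and color degrees -/

section Flip

variable (C : G.EdgeLabeling (Fin k)) (a b : Fin k) (S T : Finset G.edgeSet)

lemma flip_apply_of_mem {e : G.edgeSet} (he : e ∈ S) : flip C a b S e = Equiv.swap a b (C e) :=
  if_pos he

lemma flip_apply_of_notMem {e : G.edgeSet} (he : e ∉ S) : flip C a b S e = C e :=
  if_neg he

lemma flip_colors_comm : flip C a b S = flip C b a S := by
  funext e
  simp only [flip, Equiv.swap_comm]

lemma flip_flip_self : flip (flip C a b S) a b S = C := by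
  funext e
  by_cases he : e ∈ S <;> simp [flip, he]

lemma flip_flip_of_disjoint (h : Disjoint S T) :
    flip (flip C a b S) a b T = flip C a b (S ∪ T) := by
  funext e
  by_cases he : e ∈ S
  · have := Finset.disjoint_left.1 h he
    simp [flip, he, this]
  · simp [flip, he]

variable {C a b S}

lemma flip_apply_eq_of_ne {e : G.edgeSet} (ha : C e ≠ a) (hb : C e ≠ b) :
    flip C a b S e = C e := by
  by_cases he : e ∈ S
  · rw [flip_apply_of_mem _ _ _ _ he, Equiv.swap_apply_of_ne_of_ne ha hb]
  · exact flip_apply_of_notMem _ _ _ _ he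

lemma flip_apply_eq_iff_of_ne {e : G.edgeSet} {x : Fin k} (ha : x ≠ a) (hb : x ≠ b) :
    flip C a b S e = x ↔ C e = x := by
  by_cases he : e ∈ S
  · rw [flip_apply_of_mem _ _ _ _ he]
    rw [Equiv.swap_apply_eq_iff, Equiv.swap_apply_of_ne_of_ne ha hb]
  · rw [flip_apply_of_notMem _ _ _ _ he]

end Flip

lemma isAltTrail_comm (C : G.EdgeLabeling (Fin k)) (a b : Fin k) {F : Finset G.edgeSet}
    {x y : V} {p : G.Walk x y} : IsAltTrail C a b F p ↔ IsAltTrail C b a F p := by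
  simp only [IsAltTrail, or_comm]

lemma card_singleton_inter (e : G.edgeSet) (T : Finset G.edgeSet) :
    ({e} ∩ T).card = if e ∈ T then 1 else 0 := by
  split_ifs with hT
  · rw [Finset.singleton_inter_of_mem hT, Finset.card_singleton]
  · rw [Finset.singleton_inter_of_notMem hT, Finset.card_empty]

variable [Fintype V]

lemma mem_edgesAt {C : G.EdgeLabeling (Fin k)} {v : V} {c : Fin k} {e : G.edgeSet} :
    e ∈ edgesAt C v c ↔ v ∈ (e : Sym2 V) ∧ C e = c := by
  simp [edgesAt]

lemma mem_walkEdges {x y : V} {p : G.Walk x y} {e : G.edgeSet} :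
    e ∈ walkEdges p ↔ (e : Sym2 V) ∈ p.edges := by
  simp [walkEdges]

lemma disjoint_edgesAt (C : G.EdgeLabeling (Fin k)) (v : V) {a b : Fin k} (hab : a ≠ b) :
    Disjoint (edgesAt C v a) (edgesAt C v b) := by
  rw [Finset.disjoint_left]
  intro e he he'
  exact hab ((mem_edgesAt.1 he).2.symm.trans (mem_edgesAt.1 he').2)

lemma isProper_iff_card_edgesAt_le_one {C : G.EdgeLabeling (Fin k)} :
    IsProper C ↔ ∀ v x, (edgesAt C v x).card ≤ 1 := by
  constructor
  · intro h v x
    rw [Finset.card_le_one]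
    intro e he f hf
    rw [mem_edgesAt] at he hf
    by_contra hne
    exact h e f (SimpleGraph.lineGraph_adj_iff_exists.2 ⟨hne, v, he.1, hf.1⟩)
      (he.2.trans hf.2.symm)
  · intro h e f hef hC
    obtain ⟨hne, v, hv, hv'⟩ := SimpleGraph.lineGraph_adj_iff_exists.1 hef
    exact hne (Finset.card_le_one.1 (h v (C f)) e (mem_edgesAt.2 ⟨hv, hC⟩) f
      (mem_edgesAt.2 ⟨hv', rfl⟩))

section Flip

variable {C : G.EdgeLabeling (Fin k)} {a b : Fin k} {S : Finset G.edgeSet}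

lemma edgesAt_flip_of_ne {v : V} {x : Fin k} (ha : x ≠ a) (hb : x ≠ b) :
    edgesAt (flip C a b S) v x = edgesAt C v x := by
  ext e
  rw [mem_edgesAt, mem_edgesAt, flip_apply_eq_iff_of_ne ha hb]

lemma edgesAt_flip_left (v : V) (hab : a ≠ b) :
    edgesAt (flip C a b S) v a = (edgesAt C v a \ S) ∪ (S ∩ edgesAt C v b) := by
  ext e
  simp only [mem_edgesAt, Finset.mem_union, Finset.mem_sdiff, Finset.mem_inter, flip]
  grind

/-- A flip of `S` exchanges, at each vertex, the edges of `S` of the two colors. -/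
lemma card_edgesAt_flip_left (v : V) (hab : a ≠ b) :
    (edgesAt (flip C a b S) v a).card + (S ∩ edgesAt C v a).card =
      (edgesAt C v a).card + (S ∩ edgesAt C v b).card := by
  have h₁ : Disjoint (edgesAt C v a \ S) (S ∩ edgesAt C v b) :=
    Disjoint.mono Finset.sdiff_subset Finset.inter_subset_right (disjoint_edgesAt C v hab)
  rw [edgesAt_flip_left v hab, Finset.card_union_of_disjoint h₁,
    Finset.inter_comm S (edgesAt C v a), add_right_comm, Finset.card_sdiff_add_card_inter]

lemma card_edgesAt_flip_right (v : V) (hab : a ≠ b) :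
    (edgesAt (flip C a b S) v b).card + (S ∩ edgesAt C v b).card =
      (edgesAt C v b).card + (S ∩ edgesAt C v a).card := by
  rw [flip_colors_comm]
  exact card_edgesAt_flip_left v hab.symm

lemma isEndVertex_iff {v : V} (hab : a ≠ b) :
    IsEndVertex C a b v ↔ (edgesAt C v a).card + (edgesAt C v b).card = 1 := by
  rw [IsEndVertex, Finset.card_union_of_disjoint (disjoint_edgesAt C v hab)]

lemma isEndVertex_flip_iff {v : V} (hab : a ≠ b) :
    IsEndVertex (flip C a b S) a b v ↔ IsEndVertex C a b v := by
  rw [isEndVertex_iff hab, isEndVertex_iff hab]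
  have h₁ := card_edgesAt_flip_left (C := C) (S := S) v hab
  have h₂ := card_edgesAt_flip_right (C := C) (S := S) v hab
  omega

end Flip

/-! ### Symmetry in the two colors -/

section ColorSymmetry

variable (C : G.EdgeLabeling (Fin k)) (a b : Fin k)

lemma isSubpath_comm {x y : V} {S : Finset G.edgeSet} :
    IsSubpath C a b x y S ↔ IsSubpath C b a x y S := by
  simp only [IsSubpath, isAltTrail_comm C a b]

lemma isAltCycle_comm {F S : Finset G.edgeSet} : IsAltCycle C a b F S ↔ IsAltCycle C b a F S := by
  simp only [IsAltCycle, isAltTrail_comm C a b]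

lemma isMaxAltTrail_comm {F S : Finset G.edgeSet} :
    IsMaxAltTrail C a b F S ↔ IsMaxAltTrail C b a F S := by
  simp only [IsMaxAltTrail, isAltTrail_comm C a b]

lemma altChains_comm (F : Finset G.edgeSet) (e : G.edgeSet) :
    altChains C a b F e = altChains C b a F e := by
  simp only [altChains, isAltCycle_comm C a b, isMaxAltTrail_comm C a b]

lemma isEndVertex_comm {v : V} : IsEndVertex C a b v ↔ IsEndVertex C b a v := by
  simp only [IsEndVertex, Finset.union_comm]

lemma subpathsAndCycles_comm : subpathsAndCycles C a b = subpathsAndCycles C b a := by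
  simp only [subpathsAndCycles, isSubpath_comm C a b, isAltCycle_comm C a b]

lemma openSubpaths_comm : openSubpaths C a b = openSubpaths C b a := by
  simp only [openSubpaths, isSubpath_comm C a b, isEndVertex_comm C a b]

lemma halfOpenSubpaths_comm : halfOpenSubpaths C a b = halfOpenSubpaths C b a := by
  simp only [halfOpenSubpaths, isSubpath_comm C a b, isEndVertex_comm C a b]

lemma halfOpenPairs_comm : halfOpenPairs C a b = halfOpenPairs C b a := by
  simp only [halfOpenPairs, halfOpenSubpaths_comm C a b]

lemma flipSubpaths_comm (B : Finset (Finset G.edgeSet)) :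
    flipSubpaths C a b B = flipSubpaths C b a B := by
  simp only [flipSubpaths, halfOpenPairs_comm C a b, flip_colors_comm C a b]

lemma recolorEdge_comm : recolorEdge a b C = recolorEdge b a C := by
  simp only [recolorEdge, flip_colors_comm C a b, or_comm]

lemma twoColorMove_comm : twoColorMove a b C = twoColorMove b a C := by
  have h : (recolorEdge a b : G.EdgeLabeling (Fin k) → _) = recolorEdge b a :=
    funext fun D => recolorEdge_comm D a b
  rw [twoColorMove, twoColorMove, flipSubpaths_comm, subpathsAndCycles_comm, h,
    Finset.pair_comm]

lemma thirdColorFlip_comm (d : Fin k) : thirdColorFlip a b d C = thirdColorFlip b a d C := by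
  simp only [thirdColorFlip, nonDeficientFlip, Finset.union_comm (edgesAt C _ a)]

lemma threeColorMove_comm (d : Fin k) : threeColorMove a b d C = threeColorMove b a d C := by
  have h : (thirdColorFlip a b d : G.EdgeLabeling (Fin k) → _) = thirdColorFlip b a d :=
    funext fun D => thirdColorFlip_comm D a b d
  have h' : ({a, b, d} : Finset (Fin k)) = {b, a, d} := Finset.insert_comm a b {d}
  rw [threeColorMove, threeColorMove, flipSubpaths_comm, openSubpaths_comm, h, h']

end ColorSymmetry

end Basics

section Directed

/-! ### Alternating trails as directed trails -/

section Directed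

variable {V : Type*} {G : SimpleGraph V} {k : ℕ}

/-- Orient the edges of color `a` from the side `true` of the bipartition `χ` to the side `false`,
and the edges of color `b` the other way round.  Then `outColor χ a b v` is the color of the edges
that leave `v`, and `outColor χ b a v` the color of the edges that enter `v`. -/
def outColor (χ : V → Bool) (a b : Fin k) (v : V) : Fin k := if χ v then a else b

lemma outColor_eq_or (χ : V → Bool) (a b : Fin k) (v : V) :
    outColor χ a b v = a ∧ outColor χ b a v = b ∨ outColor χ a b v = b ∧ outColor χ b a v = a := by
  unfold outColor
  split <;> simp

lemma outColor_ne (χ : V → Bool) {a b : Fin k} (hab : a ≠ b) (v : V) :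
    outColor χ a b v ≠ outColor χ b a v := by
  unfold outColor
  split
  exacts [hab, hab.symm]

lemma eq_or_eq_iff_outColor (χ : V → Bool) (a b : Fin k) (v : V) {x : Fin k} :
    x = a ∨ x = b ↔ x = outColor χ a b v ∨ x = outColor χ b a v := by
  unfold outColor
  split
  exacts [Iff.rfl, or_comm]

lemma outColor_eq_of_adj {χ : V → Bool} (hχ : ∀ u v, G.Adj u v → χ u ≠ χ v) (a b : Fin k)
    {u v : V} (h : G.Adj u v) : outColor χ b a v = outColor χ a b u := by
  have := hχ u v h
  unfold outColor
  cases hu : χ u <;> cases hv : χ v <;> simp_all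

/-- A walk all of whose edges are traversed along the orientation by the colors `a` and `b`. -/
def IsDirected (C : G.EdgeLabeling (Fin k)) (χ : V → Bool) (a b : Fin k) {x y : V}
    (p : G.Walk x y) : Prop :=
  ∀ d ∈ p.darts, C ⟨d.edge, d.edge_mem⟩ = outColor χ a b d.fst

variable {C : G.EdgeLabeling (Fin k)} {χ : V → Bool} {a b : Fin k} {x y z : V}

lemma isDirected_nil : IsDirected C χ a b (SimpleGraph.Walk.nil : G.Walk x x) := by
  simp [IsDirected]

lemma isDirected_cons {h : G.Adj x y} {p : G.Walk y z} :
    IsDirected C χ a b (SimpleGraph.Walk.cons h p) ↔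
      C ⟨s(x, y), h⟩ = outColor χ a b x ∧ IsDirected C χ a b p := by
  simp only [IsDirected, SimpleGraph.Walk.darts_cons, List.forall_mem_cons]
  rfl

lemma isDirected_append {p : G.Walk x y} {q : G.Walk y z} :
    IsDirected C χ a b (p.append q) ↔ IsDirected C χ a b p ∧ IsDirected C χ a b q := by
  simp only [IsDirected, SimpleGraph.Walk.darts_append, List.forall_mem_append]

lemma isDirected_concat {h : G.Adj y z} {p : G.Walk x y} :
    IsDirected C χ a b (p.concat h) ↔
      IsDirected C χ a b p ∧ C ⟨s(y, z), h⟩ = outColor χ a b y := by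
  rw [SimpleGraph.Walk.concat_eq_append, isDirected_append, isDirected_cons]
  simp [isDirected_nil]

lemma IsDirected.reverse (hχ : ∀ u v, G.Adj u v → χ u ≠ χ v) {p : G.Walk x y}
    (hp : IsDirected C χ a b p) : IsDirected C χ b a p.reverse := by
  induction p with
  | nil => exact isDirected_nil
  | cons h p ih =>
    rw [isDirected_cons] at hp
    rw [SimpleGraph.Walk.reverse_cons, ← SimpleGraph.Walk.concat_eq_append, isDirected_concat]
    refine ⟨ih hp.2, ?_⟩
    rw [outColor_eq_of_adj hχ a b h, ← hp.1]
    congr 2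
    exact Sym2.eq_swap

lemma IsDirected.congr {D : G.EdgeLabeling (Fin k)} {p : G.Walk x y}
    (h : ∀ e : G.edgeSet, (e : Sym2 V) ∈ p.edges → D e = C e) (hp : IsDirected C χ a b p) :
    IsDirected D χ a b p := by
  intro d hd
  rw [h _ (List.mem_map_of_mem hd)]
  exact hp d hd

/-- Interchanging the two colors along a walk turns its orientation around. -/
lemma IsDirected.swap {D : G.EdgeLabeling (Fin k)} {p : G.Walk x y}
    (h : ∀ e : G.edgeSet, (e : Sym2 V) ∈ p.edges → D e = Equiv.swap a b (C e))
    (hp : IsDirected C χ a b p) : IsDirected D χ b a p := by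
  intro d hd
  rw [h _ (List.mem_map_of_mem hd), hp d hd]
  unfold outColor
  split <;> simp

lemma IsDirected.color_mem {p : G.Walk x y} (hp : IsDirected C χ a b p) {e : G.edgeSet}
    (he : (e : Sym2 V) ∈ p.edges) : C e = a ∨ C e = b := by
  obtain ⟨d, hd, hde⟩ := List.mem_map.1 he
  have : e = ⟨d.edge, d.edge_mem⟩ := Subtype.ext hde.symm
  rw [this, hp d hd, eq_or_eq_iff_outColor χ a b d.fst]
  exact Or.inl rfl

lemma colorsAlong_cons {h : G.Adj x y} {p : G.Walk y z} :
    colorsAlong C (SimpleGraph.Walk.cons h p) = C ⟨s(x, y), h⟩ :: colorsAlong C p :=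
  rfl

lemma IsDirected.isChain_colorsAlong (hχ : ∀ u v, G.Adj u v → χ u ≠ χ v) (hab : a ≠ b)
    {p : G.Walk x y} (hp : IsDirected C χ a b p) : (colorsAlong C p).IsChain (· ≠ ·) := by
  induction p with
  | nil => exact List.IsChain.nil
  | cons h p ih =>
    rw [isDirected_cons] at hp
    cases p with
    | nil => exact List.IsChain.singleton _
    | cons h' p =>
      rw [colorsAlong_cons, colorsAlong_cons, List.isChain_cons_cons]
      refine ⟨?_, ih hp.2⟩
      rw [hp.1, (isDirected_cons.1 hp.2).1, ← outColor_eq_of_adj hχ a b h]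
      exact outColor_ne χ hab.symm _

lemma IsDirected.getLast?_colorsAlong (hχ : ∀ u v, G.Adj u v → χ u ≠ χ v) {x y : V}
    {p : G.Walk x y} (hp : IsDirected C χ a b p) (hnil : ¬ p.Nil) :
    (colorsAlong C p).getLast? = some (outColor χ b a y) := by
  induction p with
  | nil => exact absurd .nil hnil
  | cons h p ih =>
    rw [isDirected_cons] at hp
    cases p with
    | nil =>
      rw [outColor_eq_of_adj hχ a b h, ← hp.1]
      rfl
    | cons h' p =>
      rw [colorsAlong_cons, colorsAlong_cons, List.getLast?_cons_cons, ← colorsAlong_cons]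
      exact ih hp.2 SimpleGraph.Walk.not_nil_cons

lemma isDirected_or_of_isChain (hχ : ∀ u v, G.Adj u v → χ u ≠ χ v)
    {p : G.Walk x y} (hc : ∀ c ∈ colorsAlong C p, c = a ∨ c = b)
    (hp : (colorsAlong C p).IsChain (· ≠ ·)) :
    IsDirected C χ a b p ∨ IsDirected C χ b a p := by
  induction p with
  | nil => exact Or.inl isDirected_nil
  | @cons u v w h p ih =>
    rw [colorsAlong_cons] at hc hp
    have hu := (eq_or_eq_iff_outColor χ a b u).1 (hc _ List.mem_cons_self)
    have hv := ih (fun c hcp => hc c (List.mem_cons_of_mem _ hcp)) hp.tail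
    rw [isDirected_cons, isDirected_cons]
    cases p with
    | nil => exact hu.imp (⟨·, isDirected_nil⟩) (⟨·, isDirected_nil⟩)
    | cons h' p =>
      rw [colorsAlong_cons, List.isChain_cons_cons] at hp
      have hne := hp.1
      have e₁ := outColor_eq_of_adj hχ a b h
      have e₂ := outColor_eq_of_adj hχ b a h
      rcases hv with hv | hv
      · refine Or.inl ⟨?_, hv⟩
        rw [(isDirected_cons.1 hv).1] at hne
        exact hu.resolve_right fun h => hne (h.trans e₂.symm)
      · refine Or.inr ⟨?_, hv⟩
        rw [(isDirected_cons.1 hv).1] at hne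
        exact hu.resolve_left fun h => hne (h.trans e₁.symm)

/-- In a bipartite graph the alternating trails are the trails that follow the orientation or
its reverse. -/
lemma isAltTrail_iff (hχ : ∀ u v, G.Adj u v → χ u ≠ χ v) (hab : a ≠ b) {p : G.Walk x y} :
    IsAltTrail C a b ∅ p ↔ p.IsTrail ∧ (IsDirected C χ a b p ∨ IsDirected C χ b a p) := by
  constructor
  · rintro ⟨h, hc, hp, -⟩
    exact ⟨h, isDirected_or_of_isChain hχ hc hp⟩
  · rintro ⟨h, hp⟩
    refine ⟨h, ?_, ?_, by simp⟩
    · intro c hc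
      obtain ⟨d, hd, rfl⟩ := List.mem_map.1 hc
      rw [eq_or_eq_iff_outColor χ a b d.fst]
      exact hp.imp (· d hd) (· d hd)
    · rcases hp with hp | hp
      exacts [hp.isChain_colorsAlong hχ hab, hp.isChain_colorsAlong hχ hab.symm]

lemma isTrail_concat {h : G.Adj y z} {p : G.Walk x y} :
    (p.concat h).IsTrail ↔ p.IsTrail ∧ s(y, z) ∉ p.edges := by
  rw [← SimpleGraph.Walk.reverse_isTrail_iff, SimpleGraph.Walk.reverse_concat,
    SimpleGraph.Walk.isTrail_cons, SimpleGraph.Walk.reverse_isTrail_iff,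
    SimpleGraph.Walk.edges_reverse, List.mem_reverse, Sym2.eq_swap]

/-- If the edge set `S` contains all or none of the edges of the colors `a` and `b` at each vertex
of a walk with these colors, and none at the first vertex, then it contains none at any vertex. -/
lemma forall_notMem_of_walk {S : Finset G.edgeSet} {x y : V} {p : G.Walk x y}
    (hp : ∀ e : G.edgeSet, (e : Sym2 V) ∈ p.edges → C e = a ∨ C e = b)
    (hS : ∀ v ∈ p.support, (∀ e ∈ S, v ∉ (e : Sym2 V)) ∨
      ∀ e : G.edgeSet, v ∈ (e : Sym2 V) → C e = a ∨ C e = b → e ∈ S)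
    (hx : ∀ e ∈ S, x ∉ (e : Sym2 V)) : ∀ v ∈ p.support, ∀ e ∈ S, v ∉ (e : Sym2 V) := by
  induction p with
  | nil => simpa using hx
  | @cons x w y h p ih =>
    simp only [SimpleGraph.Walk.support_cons, List.forall_mem_cons] at hS ⊢
    refine ⟨hx, ih (fun e he => hp e (List.mem_cons_of_mem _ he)) hS.2 ?_⟩
    refine (hS.2 w p.start_mem_support).resolve_right fun hw => ?_
    exact hx ⟨s(x, w), h⟩
      (hw ⟨s(x, w), h⟩ (Sym2.mem_mk_right _ _) (hp ⟨s(x, w), h⟩ List.mem_cons_self))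
      (Sym2.mem_mk_left _ _)

end Directed

section Counting

variable {V : Type*} [Fintype V] {G : SimpleGraph V} {k : ℕ}
  {C : G.EdgeLabeling (Fin k)} {χ : V → Bool} {a b : Fin k} {x y z : V}

lemma walkEdges_nil : walkEdges (SimpleGraph.Walk.nil : G.Walk x x) = ∅ := by
  ext e
  simp [mem_walkEdges]

lemma walkEdges_cons {h : G.Adj x y} {p : G.Walk y z} :
    walkEdges (SimpleGraph.Walk.cons h p) = insert ⟨s(x, y), h⟩ (walkEdges p) := by
  ext e
  simp [mem_walkEdges, Subtype.ext_iff]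

lemma walkEdges_reverse {p : G.Walk x y} : walkEdges p.reverse = walkEdges p := by
  ext e
  simp [mem_walkEdges]

/-- The visits of a directed trail to a vertex `v`, counted by the edges through which the trail
leaves `v`. -/
lemma IsDirected.count_support_out (hχ : ∀ u v, G.Adj u v → χ u ≠ χ v) (hab : a ≠ b)
    {p : G.Walk x y} (ht : p.IsTrail) (hp : IsDirected C χ a b p) (v : V) :
    p.support.count v =
      (walkEdges p ∩ edgesAt C v (outColor χ a b v)).card + if v = y then 1 else 0 := by
  induction p with
  | nil => simp [walkEdges_nil, List.count_cons, eq_comm (a := v)]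
  | @cons u w y h p ih =>
    rw [isDirected_cons] at hp
    have ht' := (SimpleGraph.Walk.isTrail_cons h p).1 ht
    have hmem : (⟨s(u, w), h⟩ : G.edgeSet) ∈ edgesAt C v (outColor χ a b v) ↔ v = u := by
      rw [mem_edgesAt, hp.1]
      constructor
      · rintro ⟨hv, hc⟩
        rcases Sym2.mem_iff.1 hv with rfl | rfl
        · rfl
        · exact absurd ((outColor_eq_of_adj hχ a b h).trans hc) (outColor_ne χ hab.symm _)
      · rintro rfl
        exact ⟨Sym2.mem_mk_left _ _, rfl⟩
    rw [SimpleGraph.Walk.support_cons, List.count_cons, ih ht'.1 hp.2, walkEdges_cons]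
    by_cases hv : v = u
    · rw [Finset.insert_inter_of_mem (hmem.2 hv), Finset.card_insert_of_notMem]
      · simp [hv]
        omega
      · exact fun h' => ht'.2 (mem_walkEdges.1 (Finset.mem_inter.1 h').1)
    · rw [Finset.insert_inter_of_notMem (hmem.not.2 hv)]
      simp [Ne.symm hv]

/-- The visits of a directed trail to a vertex `v`, counted by the edges through which the trail
enters `v`. -/
lemma IsDirected.count_support_in (hχ : ∀ u v, G.Adj u v → χ u ≠ χ v) (hab : a ≠ b)
    {p : G.Walk x y} (ht : p.IsTrail) (hp : IsDirected C χ a b p) (v : V) :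
    p.support.count v =
      (walkEdges p ∩ edgesAt C v (outColor χ b a v)).card + if v = x then 1 else 0 := by
  have := (hp.reverse hχ).count_support_out hχ hab.symm (SimpleGraph.Walk.IsTrail.reverse _ ht) v
  rwa [SimpleGraph.Walk.support_reverse, List.count_reverse, walkEdges_reverse] at this

/-- A trail that follows the orientation by the colors `a` and `b` and that cannot be extended at
its ends: it contains all edges leaving its last vertex and all edges entering its first vertex. -/
structure IsMaxDirected (C : G.EdgeLabeling (Fin k)) (χ : V → Bool) (a b : Fin k) {x y : V}
    (p : G.Walk x y) : Prop where
  isTrail : p.IsTrail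
  isDirected : IsDirected C χ a b p
  out_subset : edgesAt C y (outColor χ a b y) ⊆ walkEdges p
  in_subset : edgesAt C x (outColor χ b a x) ⊆ walkEdges p

lemma IsMaxDirected.reverse (hχ : ∀ u v, G.Adj u v → χ u ≠ χ v) {p : G.Walk x y}
    (hp : IsMaxDirected C χ a b p) : IsMaxDirected C χ b a p.reverse where
  isTrail := SimpleGraph.Walk.IsTrail.reverse _ hp.isTrail
  isDirected := hp.isDirected.reverse hχ
  out_subset := (walkEdges_reverse (p := p)).symm ▸ hp.in_subset
  in_subset := (walkEdges_reverse (p := p)).symm ▸ hp.out_subset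

lemma IsMaxDirected.congr {D : G.EdgeLabeling (Fin k)} {p : G.Walk x y}
    (hp : IsMaxDirected C χ a b p)
    (h : ∀ e : G.edgeSet, ∀ v ∈ p.support, v ∈ (e : Sym2 V) → D e = C e) :
    IsMaxDirected D χ a b p := by
  have h' : ∀ v ∈ p.support, ∀ c, edgesAt D v c = edgesAt C v c := by
    intro v hv c
    ext e
    rw [mem_edgesAt, mem_edgesAt]
    exact and_congr_right fun he => by rw [h e v hv he]
  refine ⟨hp.isTrail, hp.isDirected.congr ?_, ?_, ?_⟩
  · intro e he
    obtain ⟨d, hd, hde⟩ := List.mem_map.1 he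
    refine h e d.fst (p.dart_fst_mem_support_of_mem_darts hd) ?_
    rw [← hde]
    exact Sym2.mem_mk_left _ _
  · rw [h' y p.end_mem_support]
    exact hp.out_subset
  · rw [h' x p.start_mem_support]
    exact hp.in_subset

lemma exists_adj_of_mem_edgesAt {v : V} {c : Fin k} {e : G.edgeSet} (he : e ∈ edgesAt C v c) :
    ∃ (w : V) (h : G.Adj v w), e = ⟨s(v, w), h⟩ := by
  obtain ⟨e, heG⟩ := e
  obtain ⟨w, rfl⟩ := Sym2.mem_iff_exists.1 (mem_edgesAt.1 he).1
  exact ⟨w, heG, rfl⟩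

lemma isMaxDirected_of_not_extendable (hχ : ∀ u v, G.Adj u v → χ u ≠ χ v) (hab : a ≠ b)
    {p : G.Walk x y} (ht : p.IsTrail) (hd : IsDirected C χ a b p)
    (h₁ : ∀ (z : V) (h : G.Adj y z), ¬ IsAltTrail C a b ∅ (p.concat h))
    (h₂ : ∀ (z : V) (h : G.Adj z x), ¬ IsAltTrail C a b ∅ (SimpleGraph.Walk.cons h p)) :
    IsMaxDirected C χ a b p := by
  refine ⟨ht, hd, ?_, ?_⟩
  · intro e he
    obtain ⟨w, h, rfl⟩ := exists_adj_of_mem_edgesAt he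
    by_contra hp
    rw [mem_walkEdges] at hp
    refine h₁ w h ((isAltTrail_iff hχ hab).2 ⟨isTrail_concat.2 ⟨ht, hp⟩, Or.inl ?_⟩)
    exact isDirected_concat.2 ⟨hd, (mem_edgesAt.1 he).2⟩
  · intro e he
    obtain ⟨w, h, rfl⟩ := exists_adj_of_mem_edgesAt he
    by_contra hp
    rw [mem_walkEdges] at hp
    refine h₂ w h.symm ((isAltTrail_iff hχ hab).2
      ⟨(SimpleGraph.Walk.isTrail_cons _ _).2 ⟨ht, by rwa [Sym2.eq_swap]⟩, Or.inl ?_⟩)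
    refine isDirected_cons.2 ⟨?_, hd⟩
    rw [← outColor_eq_of_adj hχ a b h.symm, ← (mem_edgesAt.1 he).2]
    congr 2
    exact Sym2.eq_swap

lemma IsMaxAltTrail.exists_isMaxDirected (hχ : ∀ u v, G.Adj u v → χ u ≠ χ v) (hab : a ≠ b)
    {S : Finset G.edgeSet} (h : IsMaxAltTrail C a b ∅ S) :
    ∃ (x y : V) (p : G.Walk x y), IsMaxDirected C χ a b p ∧ walkEdges p = S := by
  obtain ⟨x, y, p, hp, h₁, h₂, rfl⟩ := h
  obtain ⟨ht, hd | hd⟩ := (isAltTrail_iff hχ hab).1 hp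
  · exact ⟨x, y, p, isMaxDirected_of_not_extendable hχ hab ht hd h₁ h₂, rfl⟩
  · simp only [isAltTrail_comm C a b] at h₁ h₂
    exact ⟨y, x, p.reverse,
      (isMaxDirected_of_not_extendable hχ hab.symm ht hd h₁ h₂).reverse hχ, walkEdges_reverse⟩

lemma IsMaxDirected.isMaxAltTrail (hχ : ∀ u v, G.Adj u v → χ u ≠ χ v) (hab : a ≠ b)
    {p : G.Walk x y} (hp : IsMaxDirected C χ a b p) (hnil : ¬ p.Nil) :
    IsMaxAltTrail C a b ∅ (walkEdges p) := by
  have hdart : ∀ {x y : V} {p : G.Walk x y}, ¬ p.Nil → IsDirected C χ a b p →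
      ¬ IsDirected C χ b a p := by
    intro x y p hnil h₁ h₂
    cases p with
    | nil => exact hnil .nil
    | cons h p =>
      exact outColor_ne χ hab _ ((isDirected_cons.1 h₁).1.symm.trans (isDirected_cons.1 h₂).1)
  refine ⟨x, y, p, (isAltTrail_iff hχ hab).2 ⟨hp.isTrail, Or.inl hp.isDirected⟩, ?_, ?_, rfl⟩
  · intro z h hz
    obtain ⟨ht, hd | hd⟩ := (isAltTrail_iff hχ hab).1 hz
    · refine (isTrail_concat.1 ht).2 (mem_walkEdges.1 (hp.out_subset (mem_edgesAt.2
        ⟨Sym2.mem_mk_left _ _, (isDirected_concat.1 hd).2⟩)))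
    · exact hdart hnil hp.isDirected (isDirected_concat.1 hd).1
  · intro z h hz
    obtain ⟨ht, hd | hd⟩ := (isAltTrail_iff hχ hab).1 hz
    · have he : (⟨s(z, x), h⟩ : G.edgeSet) ∈ edgesAt C x (outColor χ b a x) := by
        refine mem_edgesAt.2 ⟨Sym2.mem_mk_right _ _, ?_⟩
        rw [outColor_eq_of_adj hχ a b h]
        exact (isDirected_cons.1 hd).1
      exact ((SimpleGraph.Walk.isTrail_cons _ _).1 ht).2 (mem_walkEdges.1 (hp.in_subset he))
    · exact hdart hnil hp.isDirected (isDirected_cons.1 hd).2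

/-- Every edge of color `a` or `b` lies on an alternating trail that cannot be extended. -/
lemma exists_isMaxAltTrail {e : G.edgeSet} (he : C e = a ∨ C e = b) :
    ∃ S, e ∈ S ∧ IsMaxAltTrail C a b ∅ S := by
  -- A longest alternating trail through `e` cannot be extended.
  let P : ℕ → Prop := fun n => ∃ (x y : V) (p : G.Walk x y), IsAltTrail C a b ∅ p ∧
    (e : Sym2 V) ∈ p.edges ∧ p.length = n
  have hP : ∃ n, P n := by
    obtain ⟨⟨u, w⟩, h⟩ := e
    refine ⟨1, u, w, SimpleGraph.Walk.cons h .nil, ?_, ?_, rfl⟩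
    · refine ⟨(SimpleGraph.Walk.isTrail_cons _ _).2 ⟨.nil, by simp⟩, ?_,
        List.IsChain.singleton _, by simp⟩
      intro c hc
      rw [List.mem_singleton.1 hc]
      exact he
    · exact List.mem_cons_self
  obtain ⟨n, hn⟩ := hP
  have hle : n ≤ G.edgeFinset.card := by
    obtain ⟨x, y, p, hp, -, rfl⟩ := hn
    exact hp.1.length_le_card_edgeFinset
  have hbound := Nat.findGreatest_spec hle hn
  set N := Nat.findGreatest P G.edgeFinset.card with hN
  have hmax : ∀ {x y : V} {p : G.Walk x y}, IsAltTrail C a b ∅ p → (e : Sym2 V) ∈ p.edges →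
      p.length ≤ N := fun {x y p} hp hep =>
    Nat.le_findGreatest hp.1.length_le_card_edgeFinset ⟨x, y, p, hp, hep, rfl⟩
  obtain ⟨x, y, p, hp, hep, hlen⟩ := hbound
  refine ⟨walkEdges p, mem_walkEdges.2 hep, x, y, p, hp, ?_, ?_, rfl⟩
  · intro z h hz
    have := hmax hz (by simp [SimpleGraph.Walk.edges_concat, hep])
    rw [SimpleGraph.Walk.length_concat] at this
    omega
  · intro z h hz
    have := hmax hz (by simp [hep])
    rw [SimpleGraph.Walk.length_cons] at this
    omega

lemma altChains_nonempty {e : G.edgeSet} (he : C e = a ∨ C e = b) :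
    (altChains C a b ∅ e).Nonempty := by
  unfold altChains
  split_ifs with h
  · obtain ⟨S, hS⟩ := h
    exact ⟨S, by simpa using hS⟩
  · obtain ⟨S, hS⟩ := exists_isMaxAltTrail he
    exact ⟨S, by simpa using hS⟩

lemma mem_of_mem_altChains {e : G.edgeSet} {S : Finset G.edgeSet}
    (hS : S ∈ altChains C a b ∅ e) : e ∈ S := by
  unfold altChains at hS
  split_ifs at hS <;> exact (Finset.mem_filter.1 hS).2.1

/-- A cycle leaves each vertex as often as it enters it. -/
lemma IsAltCycle.card_inter (hχ : ∀ u v, G.Adj u v → χ u ≠ χ v) (hab : a ≠ b)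
    {S : Finset G.edgeSet} (h : IsAltCycle C a b ∅ S) (v : V) :
    (S ∩ edgesAt C v (outColor χ a b v)).card = (S ∩ edgesAt C v (outColor χ b a v)).card := by
  obtain ⟨x, p, -, hp, -, rfl⟩ := h
  obtain ⟨ht, hd | hd⟩ := (isAltTrail_iff hχ hab).1 hp
  · have h₁ := hd.count_support_out hχ hab ht v
    have h₂ := hd.count_support_in hχ hab ht v
    omega
  · have h₁ := hd.count_support_out hχ hab.symm ht v
    have h₂ := hd.count_support_in hχ hab.symm ht v
    omega

/-- A trail counted by the edges through which it leaves and enters a vertex. -/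
lemma IsMaxDirected.card_inter (hχ : ∀ u v, G.Adj u v → χ u ≠ χ v) (hab : a ≠ b)
    {p : G.Walk x y} (hp : IsMaxDirected C χ a b p) (v : V) :
    ((walkEdges p ∩ edgesAt C v (outColor χ a b v)).card + if v = y then 1 else 0) =
      (walkEdges p ∩ edgesAt C v (outColor χ b a v)).card + if v = x then 1 else 0 := by
  rw [← hp.isDirected.count_support_out hχ hab hp.isTrail,
    ← hp.isDirected.count_support_in hχ hab hp.isTrail]

/-- At a vertex with at most one edge of each color, a maximal trail contains both the edge
entering the vertex and the edge leaving it, as far as they exist, or none of them. -/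
lemma IsMaxDirected.inter_eq (hχ : ∀ u v, G.Adj u v → χ u ≠ χ v) (hab : a ≠ b)
    {p : G.Walk x y} (hp : IsMaxDirected C χ a b p) {v : V}
    (h₁ : (edgesAt C v (outColor χ a b v)).card ≤ 1)
    (h₂ : (edgesAt C v (outColor χ b a v)).card ≤ 1) :
    (walkEdges p ∩ edgesAt C v (outColor χ a b v) = ∅ ∧
        walkEdges p ∩ edgesAt C v (outColor χ b a v) = ∅) ∨
      (edgesAt C v (outColor χ a b v) ⊆ walkEdges p ∧
        edgesAt C v (outColor χ b a v) ⊆ walkEdges p) := by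
  have h := hp.card_inter hχ hab v
  have hout := hp.out_subset
  have hin := hp.in_subset
  set S := walkEdges p
  set O := edgesAt C v (outColor χ a b v) with hO
  set I := edgesAt C v (outColor χ b a v) with hI
  have hO' : (S ∩ O).card ≤ O.card := Finset.card_le_card Finset.inter_subset_right
  have hI' : (S ∩ I).card ≤ I.card := Finset.card_le_card Finset.inter_subset_right
  have full : ∀ T : Finset G.edgeSet, T.card ≤ (S ∩ T).card → T ⊆ S := fun T hT =>
    Finset.inter_eq_right.1 (Finset.eq_of_subset_of_card_le Finset.inter_subset_right hT)
  by_cases hy : v = y <;> by_cases hx : v = x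
  · subst hy hx
    exact Or.inr ⟨hout, hin⟩
  · subst hy
    simp only [if_true, if_neg hx] at h
    exact Or.inr ⟨hout, full I (by omega)⟩
  · subst hx
    simp only [if_true, if_neg hy] at h
    exact Or.inr ⟨full O (by omega), hin⟩
  · simp only [if_neg hx, if_neg hy] at h
    rcases Nat.eq_zero_or_pos (S ∩ O).card with h0 | h0
    · exact Or.inl ⟨Finset.card_eq_zero.1 h0, Finset.card_eq_zero.1 (by omega)⟩
    · exact Or.inr ⟨full O (by omega), full I (by omega)⟩

end Counting

end Directed

section NearProper

variable {V : Type*} [Fintype V] {G : SimpleGraph V} {k : ℕ}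
  {C D : G.EdgeLabeling (Fin k)} {χ : V → Bool} {a b : Fin k}

/-! ### Nearly proper labelings -/

/-- The number of edges leaving `v` in the orientation by the colors `a` and `b`; the number of
edges entering `v` is `outDeg C χ b a v`. -/
def outDeg (C : G.EdgeLabeling (Fin k)) (χ : V → Bool) (a b : Fin k) (v : V) : ℕ :=
  (edgesAt C v (outColor χ a b v)).card

/-- A labeling that is proper except for at most two deficiencies, both with the colors `a` and
`b`: in the orientation by these colors there is at most one source, with out-degree two and
in-degree zero, and at most one sink, with in-degree two and out-degree zero, and no other vertex
has out-degree or in-degree above one. -/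
structure IsNearProper (C : G.EdgeLabeling (Fin k)) (χ : V → Bool) (a b : Fin k) : Prop where
  other : ∀ v x, x ≠ a → x ≠ b → (edgesAt C v x).card ≤ 1
  degrees : ∀ v, (outDeg C χ a b v ≤ 1 ∧ outDeg C χ b a v ≤ 1) ∨
    (outDeg C χ a b v = 2 ∧ outDeg C χ b a v = 0) ∨
    (outDeg C χ a b v = 0 ∧ outDeg C χ b a v = 2)
  source_unique : ∀ u v, outDeg C χ a b u = 2 → outDeg C χ a b v = 2 → u = v
  sink_unique : ∀ u v, outDeg C χ b a u = 2 → outDeg C χ b a v = 2 → u = v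

lemma IsNearProper.symm (h : IsNearProper C χ a b) : IsNearProper C χ b a where
  other v x hb ha := h.other v x ha hb
  degrees v := by
    rcases h.degrees v with h | h | h
    exacts [Or.inl h.symm, Or.inr (Or.inr h.symm), Or.inr (Or.inl h.symm)]
  source_unique := h.sink_unique
  sink_unique := h.source_unique

lemma outDeg_add_outDeg (C : G.EdgeLabeling (Fin k)) (χ : V → Bool) (a b : Fin k) (v : V) :
    outDeg C χ a b v + outDeg C χ b a v = (edgesAt C v a).card + (edgesAt C v b).card := by
  unfold outDeg outColor
  split
  exacts [rfl, add_comm _ _]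

lemma isEndVertex_iff_outDeg (hab : a ≠ b) {v : V} :
    IsEndVertex C a b v ↔ outDeg C χ a b v + outDeg C χ b a v = 1 := by
  rw [isEndVertex_iff hab, outDeg_add_outDeg]

lemma outDeg_flip (χ : V → Bool) (hab : a ≠ b) (S : Finset G.edgeSet) (v : V) :
    outDeg (flip C a b S) χ a b v + (S ∩ edgesAt C v (outColor χ a b v)).card =
      outDeg C χ a b v + (S ∩ edgesAt C v (outColor χ b a v)).card := by
  unfold outDeg outColor
  split
  exacts [card_edgesAt_flip_left v hab, card_edgesAt_flip_right v hab]

lemma outDeg_flip' (χ : V → Bool) (hab : a ≠ b) (S : Finset G.edgeSet) (v : V) :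
    outDeg (flip C a b S) χ b a v + (S ∩ edgesAt C v (outColor χ b a v)).card =
      outDeg C χ b a v + (S ∩ edgesAt C v (outColor χ a b v)).card := by
  rw [flip_colors_comm]
  exact outDeg_flip χ hab.symm S v

lemma card_edgesAt_le_outDeg (C : G.EdgeLabeling (Fin k)) (χ : V → Bool) (a b : Fin k) (v : V)
    {n : ℕ} (h₁ : outDeg C χ a b v ≤ n) (h₂ : outDeg C χ b a v ≤ n) :
    (edgesAt C v a).card ≤ n ∧ (edgesAt C v b).card ≤ n := by
  unfold outDeg at h₁ h₂
  rcases outColor_eq_or χ a b v with ⟨h, h'⟩ | ⟨h, h'⟩ <;> rw [h] at h₁ <;> rw [h'] at h₂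
  exacts [⟨h₁, h₂⟩, ⟨h₂, h₁⟩]

lemma IsProper.outDeg_le_one (h : IsProper C) (χ : V → Bool) (a b : Fin k) (v : V) :
    outDeg C χ a b v ≤ 1 :=
  isProper_iff_card_edgesAt_le_one.1 h v _

lemma IsNearProper.isProper (h : IsNearProper C χ a b) (h₁ : ∀ v, outDeg C χ a b v ≠ 2)
    (h₂ : ∀ v, outDeg C χ b a v ≠ 2) : IsProper C := by
  rw [isProper_iff_card_edgesAt_le_one]
  intro v x
  have hv : outDeg C χ a b v ≤ 1 ∧ outDeg C χ b a v ≤ 1 := by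
    rcases h.degrees v with h | h | h
    exacts [h, absurd h.1 (h₁ v), absurd h.2 (h₂ v)]
  have := card_edgesAt_le_outDeg C χ a b v hv.1 hv.2
  by_cases ha : x = a
  · exact ha ▸ this.1
  by_cases hb : x = b
  · exact hb ▸ this.2
  exact h.other v x ha hb

lemma IsNearProper.hasDeficiency (h : IsNearProper C χ a b) {u : V}
    (hu : outDeg C χ a b u = 2) : HasDeficiency C u (outColor χ a b u) (outColor χ b a u) := by
  have hin : outDeg C χ b a u = 0 := by
    rcases h.degrees u with h | h | h <;> omega
  refine ⟨hu, fun d hd => ?_, Finset.card_eq_zero.1 hin⟩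
  by_cases hd' : d = outColor χ b a u
  · rw [hd']
    exact hin.le.trans zero_le_one
  · have := (eq_or_eq_iff_outColor χ a b u (x := d)).not.2 (by tauto)
    push Not at this
    exact h.other u d this.1 this.2

lemma mem_deficient {v : V} : v ∈ deficient C ↔ ∃ c c', HasDeficiency C v c c' := by
  simp [deficient]

lemma IsProper.deficient_eq_empty (h : IsProper C) : deficient C = ∅ := by
  rw [Finset.eq_empty_iff_forall_notMem]
  intro v hv
  obtain ⟨c, c', hc⟩ := mem_deficient.1 hv
  have := isProper_iff_card_edgesAt_le_one.1 h v c
  have := hc.1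
  omega

lemma IsNearProper.mem_deficient_iff (h : IsNearProper C χ a b) {v : V} :
    v ∈ deficient C ↔ outDeg C χ a b v = 2 ∨ outDeg C χ b a v = 2 := by
  constructor
  · intro hv
    obtain ⟨c, c', hc⟩ := mem_deficient.1 hv
    by_contra hne
    push Not at hne
    have hv : outDeg C χ a b v ≤ 1 ∧ outDeg C χ b a v ≤ 1 := by
      rcases h.degrees v with h | h | h
      exacts [h, absurd h.1 hne.1, absurd h.2 hne.2]
    have h2 := hc.1
    have h1 := card_edgesAt_le_outDeg C χ a b v hv.1 hv.2
    have h3 := h.other v c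
    by_cases ha : c = a
    · subst ha
      omega
    by_cases hb : c = b
    · subst hb
      omega
    have := h3 ha hb
    omega
  · rintro (hv | hv)
    · exact mem_deficient.2 ⟨_, _, h.hasDeficiency hv⟩
    · exact mem_deficient.2 ⟨_, _, h.symm.hasDeficiency hv⟩

lemma IsNearProper.mem_repeatedEdges (h : IsNearProper C χ a b) {u : V}
    (hu : outDeg C χ a b u = 2) {e : G.edgeSet} (he : e ∈ edgesAt C u (outColor χ a b u)) :
    e ∈ repeatedEdges C u := by
  rw [mem_edgesAt] at he
  simp only [repeatedEdges, Finset.mem_filter, Finset.mem_univ, true_and]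
  exact ⟨he.1, _, he.2 ▸ h.hasDeficiency hu⟩

/-! ### The maximal alternating path from a deficient vertex -/

lemma not_isAltCycle_of_outDeg_eq_zero (hχ : ∀ u v, G.Adj u v → χ u ≠ χ v) (hab : a ≠ b) {u : V}
    (hin : outDeg C χ b a u = 0) {e : G.edgeSet} (he : e ∈ edgesAt C u (outColor χ a b u)) :
    ¬ ∃ S, e ∈ S ∧ IsAltCycle C a b ∅ S := by
  rintro ⟨S, heS, hS⟩
  have h := hS.card_inter hχ hab u
  have h0 : S ∩ edgesAt C u (outColor χ b a u) = ∅ := by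
    rw [Finset.card_eq_zero.1 hin, Finset.inter_empty]
  rw [h0, Finset.card_empty, Finset.card_eq_zero] at h
  exact Finset.notMem_empty e (h ▸ Finset.mem_inter.2 ⟨heS, he⟩)

/-- The maximal alternating trail through an edge at a source is a path from the source to the
sink or to an end vertex. -/
lemma IsNearProper.exists_path (hχ : ∀ u v, G.Adj u v → χ u ≠ χ v) (hab : a ≠ b)
    (h : IsNearProper C χ a b) {u : V} (hu : outDeg C χ a b u = 2) {e : G.edgeSet}
    (he : e ∈ edgesAt C u (outColor χ a b u)) {S : Finset G.edgeSet}
    (hS : S ∈ altChains C a b ∅ e) :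
    ∃ (t : V) (p : G.Walk u t), IsMaxDirected C χ a b p ∧ p.IsPath ∧ walkEdges p = S ∧ t ≠ u ∧
      (outDeg C χ b a t = 2 ∨ outDeg C χ a b t = 0 ∧ outDeg C χ b a t = 1) := by
  have hin : outDeg C χ b a u = 0 := by
    rcases h.degrees u with h | h | h <;> omega
  have heS := mem_of_mem_altChains hS
  rw [altChains, if_neg (not_isAltCycle_of_outDeg_eq_zero hχ hab hin he)] at hS
  obtain ⟨x, t, p, hp, rfl⟩ :=
    (Finset.mem_filter.1 hS).2.2.exists_isMaxDirected (χ := χ) hχ hab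
  have hu' := hp.card_inter hχ hab u
  have h0 : walkEdges p ∩ edgesAt C u (outColor χ b a u) = ∅ := by
    rw [Finset.card_eq_zero.1 hin, Finset.inter_empty]
  have hpos : 0 < (walkEdges p ∩ edgesAt C u (outColor χ a b u)).card :=
    Finset.card_pos.2 ⟨e, Finset.mem_inter.2 ⟨heS, he⟩⟩
  rw [h0, Finset.card_empty] at hu'
  have hux : u = x := by
    by_contra hne
    rw [if_neg hne] at hu'
    omega
  subst hux
  have hut : u ≠ t := by
    intro hut
    simp only [if_true, if_pos hut] at hu'
    omega
  have hu1 : (walkEdges p ∩ edgesAt C u (outColor χ a b u)).card = 1 := by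
    simpa [hut] using hu'
  have hout : ∀ v, (walkEdges p ∩ edgesAt C v (outColor χ a b v)).card ≤ outDeg C χ a b v :=
    fun v => Finset.card_le_card Finset.inter_subset_right
  have hin' : ∀ v, (walkEdges p ∩ edgesAt C v (outColor χ b a v)).card ≤ outDeg C χ b a v :=
    fun v => Finset.card_le_card Finset.inter_subset_right
  have ht := hp.card_inter hχ hab t
  rw [if_pos rfl, if_neg hut.symm] at ht
  have ht' : (walkEdges p ∩ edgesAt C t (outColor χ a b t)).card = outDeg C χ a b t := by
    rw [Finset.inter_eq_right.2 hp.out_subset, outDeg]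
  have htd : outDeg C χ a b t = 0 ∧ (outDeg C χ b a t = 2 ∨ outDeg C χ b a t = 1) := by
    have := hin' t
    rcases h.degrees t with h' | h' | h'
    · omega
    · exact absurd (h.source_unique _ _ hu h'.1) hut
    · omega
  refine ⟨t, p, hp, ?_, rfl, hut.symm, by tauto⟩
  refine SimpleGraph.Walk.IsPath.mk' (List.nodup_iff_count_le_one.2 fun v => ?_)
  rw [hp.isDirected.count_support_out hχ hab hp.isTrail]
  by_cases hvt : v = t
  · subst hvt
    rw [if_pos rfl]
    omega
  by_cases hvu : v = u
  · subst hvu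
    rw [if_neg hvt]
    omega
  · rw [if_neg hvt]
    have := hout v
    rcases h.degrees v with h' | h' | h'
    · omega
    · exact absurd (h.source_unique _ _ h'.1 hu) hvu
    · omega

/-- Flipping the maximal alternating path from the source `u` to `t` removes the deficiencies of
`u` and `t` and creates no new ones. -/
lemma IsNearProper.flip_path (hχ : ∀ u v, G.Adj u v → χ u ≠ χ v) (hab : a ≠ b)
    (h : IsNearProper C χ a b) {u t : V} (hu : outDeg C χ a b u = 2) {p : G.Walk u t}
    (hp : IsMaxDirected C χ a b p) (hpath : p.IsPath) (htu : t ≠ u)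
    (ht : outDeg C χ b a t = 2 ∨ outDeg C χ a b t = 0 ∧ outDeg C χ b a t = 1) :
    IsNearProper (flip C a b (walkEdges p)) χ a b ∧
      (∀ v, outDeg (flip C a b (walkEdges p)) χ a b v ≠ 2) ∧
      ∀ v, outDeg (flip C a b (walkEdges p)) χ b a v = 2 → outDeg C χ b a v = 2 ∧ v ≠ t := by
  set S := walkEdges p with hS
  have key : ∀ v, ((outDeg (flip C a b S) χ a b v ≤ 1 ∧ outDeg (flip C a b S) χ b a v ≤ 1) ∨
      (outDeg C χ b a v = 2 ∧ v ≠ t ∧ outDeg (flip C a b S) χ a b v = 0 ∧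
        outDeg (flip C a b S) χ b a v = 2)) := by
    intro v
    have h₁ := outDeg_flip (C := C) χ hab S v
    have h₂ := outDeg_flip' (C := C) χ hab S v
    have h₃ := hp.card_inter hχ hab v
    have hout : (S ∩ edgesAt C v (outColor χ a b v)).card ≤ outDeg C χ a b v :=
      Finset.card_le_card Finset.inter_subset_right
    have hin : (S ∩ edgesAt C v (outColor χ b a v)).card ≤ outDeg C χ b a v :=
      Finset.card_le_card Finset.inter_subset_right
    rw [← hS] at h₃
    by_cases hvt : v = t
    · have h₄ := h.degrees t
      subst hvt
      rw [if_pos rfl, if_neg htu] at h₃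
      omega
    by_cases hvu : v = u
    · have h₄ := h.degrees u
      subst hvu
      rw [if_neg hvt, if_pos rfl] at h₃
      omega
    rw [if_neg hvt, if_neg hvu] at h₃
    rcases h.degrees v with h' | h' | h'
    · omega
    · exact absurd (h.source_unique _ _ h'.1 hu) hvu
    · exact Or.inr ⟨h'.2, hvt, by omega, by omega⟩
  refine ⟨⟨?_, ?_, ?_, ?_⟩, ?_, ?_⟩
  · intro v x ha hb
    rw [edgesAt_flip_of_ne ha hb]
    exact h.other v x ha hb
  · intro v
    rcases key v with h' | h'
    exacts [Or.inl h', Or.inr (Or.inr h'.2.2)]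
  · intro v _ hv
    have := key v
    omega
  · intro v w hv hw
    have h₁ := key v
    have h₂ := key w
    exact h.sink_unique _ _ (by omega) (by omega)
  · intro v
    have := key v
    omega
  · intro v hv
    rcases key v with h' | h'
    · omega
    · exact ⟨h'.1, h'.2.1⟩

/-! ### Resolving the deficiencies -/

/-- The labeling `D` is hidden behind the edge coloring `C`: the flip of sub-paths of the colors
`a` and `b` at the beginning of a step can turn `C` into `D`.  If `D` is itself an edge coloring,
nothing is hidden, and `C` is required to be `D`. -/
structure Resolves (a b : Fin k) (C D : G.EdgeLabeling (Fin k)) : Prop where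
  isProper : IsProper C
  mem_support : D ∈ (flipSubpaths C a b (openSubpaths C a b)).support
  eq_of_isProper : IsProper D → C = D

lemma resolves_comm : Resolves a b C D ↔ Resolves b a C D := by
  have : ∀ {a b : Fin k}, Resolves a b C D → Resolves b a C D := fun h =>
    ⟨h.isProper, by rw [flipSubpaths_comm, openSubpaths_comm]; exact h.mem_support,
      h.eq_of_isProper⟩
  exact ⟨this, this⟩

lemma IsProper.resolves_self (h : IsProper C) (a b : Fin k) : Resolves a b C C :=
  ⟨h, mem_support_threeWay.2 (Or.inl (by simp)), fun _ => rfl⟩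

lemma mem_openSubpaths {S : Finset G.edgeSet} : S ∈ openSubpaths C a b ↔
    ∃ x y, IsSubpath C a b x y S ∧ (¬ IsEndVertex C a b x ∨ ¬ IsEndVertex C a b y) := by
  simp [openSubpaths]

lemma mem_halfOpenSubpaths {S : Finset G.edgeSet} : S ∈ halfOpenSubpaths C a b ↔
    ∃ x y, IsSubpath C a b x y S ∧ Xor (IsEndVertex C a b x) (IsEndVertex C a b y) := by
  simp [halfOpenSubpaths]

lemma mem_support_flipSubpaths_of_mem {B : Finset (Finset G.edgeSet)} {S : Finset G.edgeSet}
    (hS : S ∈ B) : flip C a b S ∈ (flipSubpaths C a b B).support :=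
  mem_support_threeWay.2 (Or.inr (Or.inl (mem_support_pick hS (by simp))))

lemma isSubpath_of_isDirected (hχ : ∀ u v, G.Adj u v → χ u ≠ χ v) (hab : a ≠ b) {x y : V}
    {p : G.Walk x y} (hp : p.IsPath) (hxy : x ≠ y) (hd : IsDirected C χ a b p) :
    IsSubpath C a b x y (walkEdges p) := by
  refine ⟨p, hp, ?_, (isAltTrail_iff hχ hab).2 ⟨hp.1, Or.inl hd⟩, rfl⟩
  rw [← SimpleGraph.Walk.not_nil_iff_lt_length]
  exact SimpleGraph.Walk.not_nil_of_ne hxy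

lemma mem_support_eliminate_of_isProper (h : IsProper C) (K : Finset (Fin k)) (n : ℕ) :
    C ∈ (eliminate K n C).support := by
  cases n with
  | zero => simp [eliminate]
  | succ n =>
    rw [eliminate]
    exact mem_support_pick_of_eq_empty h.deficient_eq_empty (by simp)

lemma IsNearProper.mem_support_eliminate_succ (h : IsNearProper D χ a b)
    {u : V} (hu : outDeg D χ a b u = 2) {e : G.edgeSet}
    (he : e ∈ edgesAt D u (outColor χ a b u)) {S : Finset G.edgeSet}
    (hS : S ∈ altChains D a b ∅ e) {K : Finset (Fin k)} (ha : a ∈ K) (hb : b ∈ K) {n : ℕ}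
    (hC : C ∈ (eliminate K n (flip D a b S)).support) :
    C ∈ (eliminate K (n + 1) D).support := by
  have hdef := h.hasDeficiency hu
  have he' := mem_edgesAt.1 he
  have hK : outColor χ b a u ∈ K := by
    rcases outColor_eq_or χ a b u with h | h <;> rw [h.2] <;> assumption
  have hflip : flip D (D e) (outColor χ b a u) S = flip D a b S := by
    rw [he'.2]
    rcases outColor_eq_or χ a b u with h | h <;> rw [h.1, h.2]
    exact flip_colors_comm ..
  have hchain : altChains D (D e) (outColor χ b a u) ∅ e = altChains D a b ∅ e := by
    rw [he'.2]
    rcases outColor_eq_or χ a b u with h | h <;> rw [h.1, h.2]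
    exact altChains_comm ..
  rw [eliminate]
  refine mem_support_pick (h.mem_deficient_iff.2 (Or.inl hu)) ?_
  refine mem_support_pick (x := (e, outColor χ b a u)) ?_ ?_
  · simp only [Finset.mem_filter, Finset.mem_univ, true_and]
    exact ⟨he'.1, hK, he'.2 ▸ hdef⟩
  · exact mem_support_pick (hchain ▸ hS) (by rw [hflip]; exact hC)

/-- A single flip of a maximal alternating path that leads to an edge coloring. -/
lemma IsNearProper.exists_resolves_of_flip (hχ : ∀ u v, G.Adj u v → χ u ≠ χ v) (hab : a ≠ b)
    (h : IsNearProper D χ a b) {u : V} (hu : outDeg D χ a b u = 2) {e : G.edgeSet}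
    (he : e ∈ edgesAt D u (outColor χ a b u)) {t : V} {p : G.Walk u t}
    (hchain : walkEdges p ∈ altChains D a b ∅ e) (hp : IsMaxDirected D χ a b p)
    (hpath : p.IsPath) (htu : t ≠ u) (hproper : IsProper (flip D a b (walkEdges p)))
    {K : Finset (Fin k)} (ha : a ∈ K) (hb : b ∈ K) :
    ∃ C, C ∈ (eliminate K (Fintype.card V) D).support ∧ Resolves a b C D := by
  set C := flip D a b (walkEdges p) with hC
  refine ⟨C, ?_, hproper, ?_, ?_⟩
  · obtain ⟨n, hn⟩ : ∃ n, Fintype.card V = n + 1 :=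
      Nat.exists_eq_succ_of_ne_zero (Fintype.card_pos_iff.2 ⟨u⟩).ne'
    rw [hn]
    exact h.mem_support_eliminate_succ hu he hchain ha hb
      (mem_support_eliminate_of_isProper hproper K n)
  · have hD : D = flip C a b (walkEdges p) := (flip_flip_self D a b _).symm
    rw [hD]
    refine mem_support_flipSubpaths_of_mem (mem_openSubpaths.2 ⟨u, t, ?_, Or.inl ?_⟩)
    · refine (isSubpath_comm ..).1 (isSubpath_of_isDirected hχ hab.symm hpath htu.symm
        (hp.isDirected.swap fun e he => ?_))
      exact flip_apply_of_mem _ _ _ _ (mem_walkEdges.2 he)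
    · rw [hC, isEndVertex_flip_iff hab, isEndVertex_iff_outDeg (χ := χ) hab]
      omega
  · intro hD
    have := hD.outDeg_le_one χ a b u
    omega

/-- The maximal alternating paths from the source to an end vertex and from the sink to an end
vertex are vertex-disjoint. -/
lemma IsNearProper.forall_notMem (hχ : ∀ u v, G.Adj u v → χ u ≠ χ v) (hab : a ≠ b)
    (h : IsNearProper D χ a b) {u y t x : V} (hu : outDeg D χ a b u = 2)
    (hy : outDeg D χ b a y = 2) {p : G.Walk u t} {q : G.Walk y x}
    (hp : IsMaxDirected D χ a b p) (hq : IsMaxDirected D χ b a q) (hty : y ≠ t) (hxu : u ≠ x) :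
    ∀ v ∈ p.support, ∀ e ∈ walkEdges q, v ∉ (e : Sym2 V) := by
  have hcol : ∀ e ∈ walkEdges q, D e = a ∨ D e = b := fun e he =>
    (hq.isDirected.color_mem (mem_walkEdges.1 he)).symm
  have none_of : ∀ v, walkEdges q ∩ edgesAt D v (outColor χ a b v) = ∅ →
      walkEdges q ∩ edgesAt D v (outColor χ b a v) = ∅ →
      ∀ e ∈ walkEdges q, v ∉ (e : Sym2 V) := by
    intro v h₁ h₂ e he hve
    rcases (eq_or_eq_iff_outColor χ a b v).1 (hcol e he) with hc | hc
    · exact Finset.notMem_empty e (h₁ ▸ Finset.mem_inter.2 ⟨he, mem_edgesAt.2 ⟨hve, hc⟩⟩)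
    · exact Finset.notMem_empty e (h₂ ▸ Finset.mem_inter.2 ⟨he, mem_edgesAt.2 ⟨hve, hc⟩⟩)
  have hyp : y ∉ p.support := by
    rw [← List.count_eq_zero, hp.isDirected.count_support_out hχ hab hp.isTrail, if_neg hty]
    have : outDeg D χ a b y = 0 := by rcases h.degrees y with h' | h' | h' <;> omega
    rw [Finset.card_eq_zero.1 this]
    simp
  have hu0 : ∀ e ∈ walkEdges q, u ∉ (e : Sym2 V) := by
    have hin : outDeg D χ b a u = 0 := by rcases h.degrees u with h' | h' | h' <;> omega
    have h₁ := hq.card_inter hχ hab.symm u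
    have h₂ : walkEdges q ∩ edgesAt D u (outColor χ b a u) = ∅ := by
      rw [Finset.card_eq_zero.1 hin, Finset.inter_empty]
    have huy : u ≠ y := by
      rintro rfl
      omega
    rw [h₂, Finset.card_empty, if_neg hxu, if_neg huy] at h₁
    exact none_of u (Finset.card_eq_zero.1 (by omega)) h₂
  refine forall_notMem_of_walk (fun e he => hp.isDirected.color_mem he) (fun v hv => ?_) hu0
  by_cases hvu : v = u
  · exact Or.inl (hvu ▸ hu0)
  have hvd : outDeg D χ a b v ≤ 1 ∧ outDeg D χ b a v ≤ 1 := by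
    rcases h.degrees v with h' | h' | h'
    · exact h'
    · exact absurd (h.source_unique _ _ h'.1 hu) hvu
    · exact absurd (h.sink_unique _ _ hy h'.2 ▸ hv) hyp
  rcases hq.inter_eq hχ hab.symm hvd.2 hvd.1 with h' | h'
  · exact Or.inl (none_of v h'.2 h'.1)
  · refine Or.inr fun e hve hc => ?_
    rcases (eq_or_eq_iff_outColor χ a b v).1 hc with hc | hc
    exacts [h'.2 (mem_edgesAt.2 ⟨hve, hc⟩), h'.1 (mem_edgesAt.2 ⟨hve, hc⟩)]

/-- If the maximal alternating path from the source ends at the sink, or the one from the sink ends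
at the source, or there is no sink, then a single flip resolves the deficiencies and is undone by
the flip of one sub-path.  Otherwise the two paths are disjoint, each of them ends at an end
vertex, and they are flipped back together as a pair of sub-paths. -/
lemma IsNearProper.exists_resolves_of_source (hχ : ∀ u v, G.Adj u v → χ u ≠ χ v) (hab : a ≠ b)
    (h : IsNearProper D χ a b) {u : V} (hu : outDeg D χ a b u = 2)
    {K : Finset (Fin k)} (ha : a ∈ K) (hb : b ∈ K) :
    ∃ C, C ∈ (eliminate K (Fintype.card V) D).support ∧ Resolves a b C D := by
  have chain : ∀ {a b : Fin k} {u : V}, outDeg D χ a b u = 2 →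
      ∃ e ∈ edgesAt D u (outColor χ a b u), ∃ S, S ∈ altChains D a b ∅ e := by
    intro a b u hu
    obtain ⟨e, he⟩ : (edgesAt D u (outColor χ a b u)).Nonempty :=
      Finset.card_pos.1 (by rw [outDeg] at hu; omega)
    refine ⟨e, he, altChains_nonempty ?_⟩
    rw [eq_or_eq_iff_outColor χ a b u]
    exact Or.inl (mem_edgesAt.1 he).2
  obtain ⟨e, he, S, hS⟩ := chain hu
  obtain ⟨t, p, hp, hpath, rfl, htu, ht⟩ := h.exists_path hχ hab hu he hS
  obtain ⟨hP₁, hP₂, hP₃⟩ := h.flip_path hχ hab hu hp hpath htu ht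
  by_cases hsink : ∀ y, outDeg D χ b a y = 2 → y = t
  · exact h.exists_resolves_of_flip hχ hab hu he hS hp hpath htu
      (hP₁.isProper hP₂ fun v hv => (hP₃ v hv).2 (hsink v (hP₃ v hv).1)) ha hb
  push Not at hsink
  obtain ⟨y, hy, hyt⟩ := hsink
  obtain ⟨f, hf, T, hT⟩ := chain hy
  obtain ⟨x, q, hq, hqpath, rfl, hxy, hx⟩ := h.symm.exists_path hχ hab.symm hy hf hT
  obtain ⟨hQ₁, hQ₂, hQ₃⟩ := h.symm.flip_path hχ hab.symm hy hq hqpath hxy hx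
  by_cases hxu : u = x
  · subst hxu
    obtain ⟨C, hC, hCD⟩ := h.symm.exists_resolves_of_flip hχ hab.symm hy hf hT hq hqpath hxy
      (hQ₁.isProper hQ₂ fun v hv => (hQ₃ v hv).2 (h.source_unique _ _ (hQ₃ v hv).1 hu)) hb ha
    exact ⟨C, hC, resolves_comm.1 hCD⟩
  -- The two paths are disjoint; the one from the sink is flipped first.
  have hdisj := h.forall_notMem hχ hab hu hy hp hq hyt hxu
  set D' := flip D b a (walkEdges q) with hD'
  have hcongr : ∀ e : G.edgeSet, ∀ v ∈ p.support, v ∈ (e : Sym2 V) → D' e = D e :=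
    fun e v hv hve => flip_apply_of_notMem _ _ _ _ fun heq => hdisj v hv e heq hve
  have hp' : IsMaxDirected D' χ a b p := hp.congr hcongr
  have hedges : ∀ c, edgesAt D' u c = edgesAt D u c := by
    intro c
    ext e
    rw [mem_edgesAt, mem_edgesAt]
    exact and_congr_right fun hue => by rw [hcongr e u p.start_mem_support hue]
  have hu' : outDeg D' χ a b u = 2 := by rw [outDeg, hedges]; exact hu
  have hN := hQ₁.symm
  have he' : e ∈ edgesAt D' u (outColor χ a b u) := by rwa [hedges]
  have hS' : walkEdges p ∈ altChains D' a b ∅ e := by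
    have hin : outDeg D' χ b a u = 0 := by rcases hN.degrees u with h | h | h <;> omega
    rw [altChains, if_neg (not_isAltCycle_of_outDeg_eq_zero hχ hab hin he')]
    exact Finset.mem_filter.2 ⟨Finset.mem_univ _, mem_of_mem_altChains hS,
      hp'.isMaxAltTrail hχ hab (SimpleGraph.Walk.not_nil_of_ne htu.symm)⟩
  have ht' : outDeg D' χ b a t = 2 ∨ outDeg D' χ a b t = 0 ∧ outDeg D' χ b a t = 1 := by
    have : ∀ c, edgesAt D' t c = edgesAt D t c := by
      intro c
      ext e
      rw [mem_edgesAt, mem_edgesAt]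
      exact and_congr_right fun hte => by rw [hcongr e t p.end_mem_support hte]
    unfold outDeg
    rw [this, this]
    exact ht
  obtain ⟨hR₁, hR₂, hR₃⟩ := hN.flip_path hχ hab hu' hp' hpath htu ht'
  set C := flip D' a b (walkEdges p) with hC
  have hCproper : IsProper C := hR₁.isProper hR₂ fun v hv => hQ₂ v (hR₃ v hv).1
  have hPQ : Disjoint (walkEdges q) (walkEdges p) := by
    rw [Finset.disjoint_left]
    rintro ⟨e, heG⟩ heq hep
    induction e with
    | _ v w =>
      exact hdisj v (p.fst_mem_support_of_mem_edges (mem_walkEdges.1 hep)) _ heq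
        (Sym2.mem_mk_left _ _)
  have hCD : C = flip D a b (walkEdges q ∪ walkEdges p) := by
    rw [hC, hD', flip_colors_comm D b a, flip_flip_of_disjoint _ _ _ _ _ hPQ]
  have hend : ∀ v, IsEndVertex C a b v ↔ outDeg D χ a b v + outDeg D χ b a v = 1 := by
    intro v
    rw [hCD, isEndVertex_flip_iff hab, isEndVertex_iff_outDeg (χ := χ) hab]
  have hswap : ∀ e ∈ walkEdges q ∪ walkEdges p, C e = Equiv.swap a b (D e) := fun e he => by
    rw [hCD]
    exact flip_apply_of_mem _ _ _ _ he
  have hP : walkEdges p ∈ halfOpenSubpaths C a b := by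
    refine mem_halfOpenSubpaths.2 ⟨u, t, ?_, Or.inr ⟨(hend t).2 ?_, fun h' => ?_⟩⟩
    · exact (isSubpath_comm ..).1 (isSubpath_of_isDirected hχ hab.symm hpath htu.symm
        (hp.isDirected.swap fun e he =>
          hswap e (Finset.mem_union_right _ (mem_walkEdges.2 he))))
    · rcases ht with ht | ht
      · exact absurd (h.sink_unique y t hy ht) hyt
      · omega
    · have := (hend u).1 h'
      omega
  have hQ : walkEdges q ∈ halfOpenSubpaths C a b := by
    refine mem_halfOpenSubpaths.2 ⟨y, x, ?_, Or.inr ⟨(hend x).2 ?_, fun h' => ?_⟩⟩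
    · refine isSubpath_of_isDirected hχ hab hqpath hxy.symm
        (hq.isDirected.swap fun e he => ?_)
      rw [hswap e (Finset.mem_union_left _ (mem_walkEdges.2 he)), Equiv.swap_comm]
    · rcases hx with hx | hx
      · exact absurd (h.source_unique u x hu hx) hxu
      · omega
    · have := (hend y).1 h'
      omega
  refine ⟨C, ?_, hCproper, ?_, fun hD => ?_⟩
  · have huy : u ≠ y := by
      rintro rfl
      rcases h.degrees u with h' | h' | h' <;> omega
    obtain ⟨n, hn⟩ : ∃ n, Fintype.card V = n + 1 + 1 :=
      Nat.exists_eq_add_of_le' (Fintype.one_lt_card_iff.2 ⟨u, y, huy⟩)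
    rw [hn]
    refine h.symm.mem_support_eliminate_succ hy hf hT hb ha ?_
    exact hN.mem_support_eliminate_succ hu' he' hS' ha hb
      (mem_support_eliminate_of_isProper hCproper K n)
  · have hne : walkEdges q ≠ walkEdges p := by
      intro heq
      rw [heq, Finset.disjoint_self_iff_empty] at hPQ
      exact Finset.notMem_empty e (hPQ ▸ mem_of_mem_altChains hS)
    have hD : D = flip C a b (({walkEdges q, walkEdges p} : Finset _).biUnion id) := by
      rw [Finset.biUnion_insert, Finset.singleton_biUnion, id, id, hCD, flip_flip_self]
    refine mem_support_threeWay.2 (Or.inr (Or.inr ?_))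
    refine mem_support_pick (x := {walkEdges q, walkEdges p}) ?_
      ((PMF.mem_support_pure_iff _ _).2 hD)
    rw [halfOpenPairs, Finset.mem_powersetCard]
    exact ⟨by simp [Finset.insert_subset_iff, hP, hQ], Finset.card_pair hne⟩
  · have := hD.outDeg_le_one χ a b u
    omega

/-- The deficiencies of a nearly proper labeling can be eliminated in such a way that the next
step can restore the labeling. -/
lemma IsNearProper.exists_resolves (hχ : ∀ u v, G.Adj u v → χ u ≠ χ v) (hab : a ≠ b)
    (h : IsNearProper D χ a b) {K : Finset (Fin k)} (ha : a ∈ K) (hb : b ∈ K) :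
    ∃ C, C ∈ (eliminate K (Fintype.card V) D).support ∧ Resolves a b C D := by
  by_cases hsource : ∃ u, outDeg D χ a b u = 2
  · obtain ⟨u, hu⟩ := hsource
    exact h.exists_resolves_of_source hχ hab hu ha hb
  by_cases hsink : ∃ u, outDeg D χ b a u = 2
  · obtain ⟨u, hu⟩ := hsink
    obtain ⟨C, hC, hCD⟩ := h.symm.exists_resolves_of_source hχ hab.symm hu hb ha
    exact ⟨C, hC, resolves_comm.1 hCD⟩
  push Not at hsource hsink
  have hD := h.isProper hsource hsink
  exact ⟨D, mem_support_eliminate_of_isProper hD _ _, hD.resolves_self a b⟩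

end NearProper

section TwoColorMoves

variable {V : Type*} [Fintype V] {G : SimpleGraph V} {k : ℕ}
  {C D : G.EdgeLabeling (Fin k)} {χ : V → Bool} {a b c d : Fin k}

/-! ### Two-color moves -/

lemma mem_support_twoColorMove (hab : a ≠ b) (hD : D ∈ (twoColorMove a b C).support) :
    D ∈ (move C).support := by
  refine mem_support_coin_right (mem_support_coin_left ?_)
  rcases lt_or_gt_of_ne hab with h | h
  · exact mem_support_pick (x := (a, b)) (by simpa using h) hD
  · exact mem_support_pick (x := (b, a)) (by simpa using h) (twoColorMove_comm C a b ▸ hD)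

lemma mem_support_threeColorMove (hab : a ≠ b) (hda : d ≠ a) (hdb : d ≠ b)
    (hD : D ∈ (threeColorMove a b d C).support) : D ∈ (move C).support := by
  refine mem_support_coin_right (mem_support_coin_right ?_)
  rcases lt_or_gt_of_ne hab with h | h
  · exact mem_support_pick (x := (a, b, d)) (by simpa using ⟨h, hda, hdb⟩) hD
  · exact mem_support_pick (x := (b, a, d)) (by simpa using ⟨h, hdb, hda⟩)
      (threeColorMove_comm C a b d ▸ hD)

lemma openSubpaths_subset_subpathsAndCycles : openSubpaths C a b ⊆ subpathsAndCycles C a b := by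
  intro S hS
  obtain ⟨x, y, h, -⟩ := mem_openSubpaths.1 hS
  simp only [subpathsAndCycles, Finset.mem_filter, Finset.mem_univ, true_and]
  exact Or.inl ⟨x, y, h⟩

lemma flipSubpaths_support_mono {B B' : Finset (Finset G.edgeSet)} (h : B ⊆ B') :
    (flipSubpaths C a b B).support ⊆ (flipSubpaths C a b B').support := by
  intro D hD
  rcases mem_support_threeWay.1 hD with hD | hD | hD
  · exact mem_support_threeWay.2 (Or.inl hD)
  · by_cases hB : B.Nonempty
    · rw [pick, dif_pos hB, PMF.mem_support_bind_iff] at hD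
      obtain ⟨S, hS, hDS⟩ := hD
      exact mem_support_threeWay.2 (Or.inr (Or.inl (mem_support_pick (h (by simpa using hS)) hDS)))
    · rw [pick, dif_neg hB] at hD
      exact mem_support_threeWay.2 (Or.inl hD)
  · exact mem_support_threeWay.2 (Or.inr (Or.inr hD))

/-- Changing the color of a single edge, if this leads from an edge coloring to an edge
coloring. -/
lemma IsProper.mem_support_move_flip_singleton (hab : a ≠ b) (hC : IsProper C) {e : G.edgeSet}
    (he : C e = a ∨ C e = b) (h : IsProper (flip C a b {e})) :
    flip C a b {e} ∈ (move C).support := by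
  refine mem_support_twoColorMove hab ?_
  rw [twoColorMove, PMF.mem_support_bind_iff]
  refine ⟨flip C a b {e}, (PMF.mem_support_bind_iff ..).2 ⟨C, ?_, ?_⟩,
    mem_support_eliminate_of_isProper h _ _⟩
  · exact mem_support_threeWay.2 (Or.inl (by simp))
  · refine mem_support_pick_of_eq_empty hC.deficient_eq_empty (mem_support_coin_left ?_)
    exact mem_support_pick (x := e) (by simpa using he) (by simp)

lemma outDeg_flip_singleton (hχ : ∀ u v, G.Adj u v → χ u ≠ χ v) (hab : a ≠ b) {u w : V}
    {h : G.Adj u w} (hg : C ⟨s(u, w), h⟩ = outColor χ a b u) (v : V) :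
    outDeg (flip C a b {⟨s(u, w), h⟩}) χ a b v + (if v = u then 1 else 0) =
        outDeg C χ a b v + (if v = w then 1 else 0) ∧
      outDeg (flip C a b {⟨s(u, w), h⟩}) χ b a v + (if v = w then 1 else 0) =
        outDeg C χ b a v + (if v = u then 1 else 0) := by
  have hw := outColor_eq_of_adj hχ a b h
  have h₁ : (⟨s(u, w), h⟩ : G.edgeSet) ∈ edgesAt C v (outColor χ a b v) ↔ v = u := by
    rw [mem_edgesAt, hg]
    constructor
    · rintro ⟨hv, hc⟩
      rcases Sym2.mem_iff.1 hv with rfl | rfl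
      · rfl
      · exact absurd (hw.trans hc) (outColor_ne χ hab.symm _)
    · rintro rfl
      exact ⟨Sym2.mem_mk_left _ _, rfl⟩
  have h₂ : (⟨s(u, w), h⟩ : G.edgeSet) ∈ edgesAt C v (outColor χ b a v) ↔ v = w := by
    rw [mem_edgesAt, hg]
    constructor
    · rintro ⟨hv, hc⟩
      rcases Sym2.mem_iff.1 hv with rfl | rfl
      · exact absurd hc (outColor_ne χ hab _)
      · rfl
    · rintro rfl
      exact ⟨Sym2.mem_mk_right _ _, hw.symm⟩
  have e₁ := outDeg_flip (C := C) χ hab {⟨s(u, w), h⟩} v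
  have e₂ := outDeg_flip' (C := C) χ hab {⟨s(u, w), h⟩} v
  simp only [card_singleton_inter, h₁, h₂] at e₁ e₂
  exact ⟨e₁, e₂⟩

/-- Flipping an edge that leaves the source moves the source along this edge. -/
lemma IsNearProper.flip_singleton (hχ : ∀ u v, G.Adj u v → χ u ≠ χ v) (hab : a ≠ b)
    (h : IsNearProper D χ a b) {u : V} (hu : outDeg D χ a b u = 2) {g : G.edgeSet}
    (hg : g ∈ edgesAt D u (outColor χ a b u)) : IsNearProper (flip D a b {g}) χ a b := by
  obtain ⟨w, huw, rfl⟩ := exists_adj_of_mem_edgesAt hg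
  have hne : u ≠ w := huw.ne
  have key := outDeg_flip_singleton hχ hab (mem_edgesAt.1 hg).2
  have hpos : 0 < outDeg D χ b a w := by
    refine Finset.card_pos.2 ⟨⟨s(u, w), huw⟩, mem_edgesAt.2 ⟨Sym2.mem_mk_right _ _, ?_⟩⟩
    rw [(mem_edgesAt.1 hg).2, outColor_eq_of_adj hχ a b huw]
  have hsource : ∀ v, outDeg (flip D a b {⟨s(u, w), huw⟩}) χ a b v = 2 → v = w := by
    intro v hv
    by_contra hvw
    have h₁ := (key v).1
    rw [if_neg hvw, hv] at h₁
    have hvu : v ≠ u := by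
      rintro rfl
      rw [if_pos rfl] at h₁
      omega
    rw [if_neg hvu] at h₁
    exact hvu (h.source_unique _ _ h₁.symm hu)
  have hsink : ∀ v, outDeg (flip D a b {⟨s(u, w), huw⟩}) χ b a v = 2 →
      outDeg D χ b a v = 2 := by
    intro v hv
    have h₂ := (key v).2
    have h₃ := h.degrees v
    by_cases hvu : v = u
    · subst hvu
      rw [if_neg hne, if_pos rfl] at h₂
      omega
    · rw [if_neg hvu] at h₂
      omega
  refine ⟨fun v x ha hb => ?_, fun v => ?_, fun v v' hv hv' => ?_, fun v v' hv hv' => ?_⟩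
  · rw [edgesAt_flip_of_ne ha hb]
    exact h.other v x ha hb
  · have h₁ := (key v).1
    have h₂ := (key v).2
    have h₃ := h.degrees v
    by_cases hvu : v = u
    · subst hvu
      rw [if_neg hne, if_pos rfl] at h₁ h₂
      omega
    by_cases hvw : v = w
    · subst hvw
      have h₄ : outDeg D χ a b v ≠ 2 := fun h' => hvu (h.source_unique _ _ h' hu)
      rw [if_pos rfl, if_neg hvu] at h₁ h₂
      omega
    · rw [if_neg hvu, if_neg hvw] at h₁ h₂
      omega
  · rw [hsource v hv, hsource v' hv']
  · exact h.sink_unique _ _ (hsink v hv) (hsink v' hv')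

/-- A two-color move can flip any edge of the repeated color at a deficient vertex of a hidden
nearly proper labeling. -/
lemma Resolves.exists_move_flip_singleton (hχ : ∀ u v, G.Adj u v → χ u ≠ χ v) (hab : a ≠ b)
    (hCD : Resolves a b C D) (h : IsNearProper D χ a b) {u : V} (hu : outDeg D χ a b u = 2)
    {g : G.edgeSet} (hg : g ∈ edgesAt D u (outColor χ a b u)) :
    ∃ C', C' ∈ (move C).support ∧ Resolves a b C' (flip D a b {g}) := by
  have hF := h.flip_singleton hχ hab hu hg
  obtain ⟨C', hC', hres⟩ := hF.exists_resolves hχ hab (K := {a, b}) (by simp) (by simp)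
  refine ⟨C', mem_support_twoColorMove hab ?_, hres⟩
  rw [twoColorMove, PMF.mem_support_bind_iff]
  refine ⟨_, (PMF.mem_support_bind_iff ..).2 ⟨D, ?_, ?_⟩, hC'⟩
  · exact flipSubpaths_support_mono openSubpaths_subset_subpathsAndCycles hCD.mem_support
  · exact mem_support_pick (h.mem_deficient_iff.2 (Or.inl hu))
      (mem_support_pick (h.mem_repeatedEdges hu hg) (by simp))

/-! ### Three-color moves -/

/-- A closed directed trail is a cycle if no vertex has both out-degree and in-degree above
one. -/
lemma IsDirected.isAltCycle (hχ : ∀ u v, G.Adj u v → χ u ≠ χ v) (hab : a ≠ b) {x y : V}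
    {h : G.Adj x y} {p : G.Walk y x} (ht : (SimpleGraph.Walk.cons h p).IsTrail)
    (hp : IsDirected C χ a b (SimpleGraph.Walk.cons h p))
    (hdeg : ∀ v, outDeg C χ a b v ≤ 1 ∨ outDeg C χ b a v ≤ 1) :
    IsAltCycle C a b ∅ (walkEdges (SimpleGraph.Walk.cons h p)) := by
  refine ⟨x, SimpleGraph.Walk.cons h p, ⟨⟨ht, by simp⟩, ?_⟩,
    (isAltTrail_iff hχ hab).2 ⟨ht, Or.inl hp⟩, ?_, rfl⟩
  · refine List.nodup_iff_count_le_one.2 fun v => ?_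
    have h₁ := hp.count_support_out hχ hab ht v
    have h₂ := hp.count_support_in hχ hab ht v
    have h₃ : (walkEdges (SimpleGraph.Walk.cons h p) ∩
        edgesAt C v (outColor χ a b v)).card ≤ outDeg C χ a b v :=
      Finset.card_le_card Finset.inter_subset_right
    have h₄ : (walkEdges (SimpleGraph.Walk.cons h p) ∩
        edgesAt C v (outColor χ b a v)).card ≤ outDeg C χ b a v :=
      Finset.card_le_card Finset.inter_subset_right
    rw [SimpleGraph.Walk.support_cons, List.count_cons] at h₁ h₂
    rw [SimpleGraph.Walk.support_cons, List.tail_cons]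
    have h₅ := hdeg v
    by_cases hv : x = v
    · simp only [hv, beq_self_eq_true, if_true] at h₁ h₂
      omega
    · simp only [Ne.symm hv, if_false, beq_eq_false_iff_ne.2 hv, Bool.false_eq_true] at h₁ h₂
      omega
  · rw [hp.getLast?_colorsAlong hχ SimpleGraph.Walk.not_nil_cons, colorsAlong_cons,
      List.head?_cons, (isDirected_cons.1 hp).1]
    exact fun h => outColor_ne χ hab x (Option.some_injective _ h)

lemma sum_card_inter_edgesAt (hχ : ∀ u v, G.Adj u v → χ u ≠ χ v) (hab : a ≠ b)
    {T : Finset G.edgeSet} (hT : ∀ e ∈ T, C e = a ∨ C e = b) :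
    ∑ v, (T ∩ edgesAt C v (outColor χ a b v)).card = T.card := by
  have h : ∀ v, T ∩ edgesAt C v (outColor χ a b v) =
      T.filter fun e => e ∈ edgesAt C v (outColor χ a b v) := fun v =>
    (Finset.filter_mem_eq_inter).symm
  simp only [h]
  refine (Finset.sum_card_bipartiteAbove_eq_sum_card_bipartiteBelow
    (fun v e => e ∈ edgesAt C v (outColor χ a b v))).trans ?_
  rw [Finset.card_eq_sum_ones]
  refine Finset.sum_congr rfl fun e he => ?_
  rw [Finset.card_eq_one]
  obtain ⟨⟨u, w⟩, huw⟩ := e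
  have huw' : G.Adj u w := huw
  have hw := outColor_eq_of_adj hχ a b huw'
  have hne := outColor_ne χ hab
  rcases (eq_or_eq_iff_outColor χ a b u).1 (hT _ he) with hc | hc
  · refine ⟨u, ?_⟩
    ext v
    simp only [Finset.mem_filter, Finset.mem_univ, true_and, Finset.mem_singleton,
      Finset.bipartiteBelow, mem_edgesAt]
    constructor
    · rintro ⟨hv, hcv⟩
      rcases Sym2.mem_iff.1 hv with rfl | rfl
      · rfl
      · exact absurd (hcv.symm.trans (hc.trans hw.symm)) (hne _)
    · rintro rfl
      exact ⟨Sym2.mem_mk_left _ _, hc⟩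
  · refine ⟨w, ?_⟩
    have hw' := outColor_eq_of_adj hχ b a huw'
    ext v
    simp only [Finset.mem_filter, Finset.mem_univ, true_and, Finset.mem_singleton,
      Finset.bipartiteBelow, mem_edgesAt]
    constructor
    · rintro ⟨hv, hcv⟩
      rcases Sym2.mem_iff.1 hv with rfl | rfl
      · exact absurd (hcv.symm.trans hc) (hne _)
      · rfl
    · rintro rfl
      exact ⟨Sym2.mem_mk_right _ _, hc.trans hw'.symm⟩

/-- Let `z` be the only vertex of out-degree two, and let it have in-degree at most one.  If no
alternating cycle passes through an edge leaving `z`, then a maximal alternating trail through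
such an edge passes `z` exactly once, because otherwise it would begin with a cycle at `z`. -/
lemma exists_isMaxDirected_of_not_cycle (hχ : ∀ u v, G.Adj u v → χ u ≠ χ v) (hab : a ≠ b) {z : V}
    (hz : outDeg C χ a b z = 2) (hz' : outDeg C χ b a z ≤ 1)
    (hout : ∀ v, v ≠ z → outDeg C χ a b v ≤ 1)
    (hcyc : ∀ s ∈ edgesAt C z (outColor χ a b z), ¬ ∃ S, s ∈ S ∧ IsAltCycle C a b ∅ S)
    {s : G.edgeSet} (hs : s ∈ edgesAt C z (outColor χ a b z)) :
    ∃ (x t : V) (p : G.Walk x t), IsMaxDirected C χ a b p ∧ s ∈ walkEdges p ∧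
      walkEdges p ∈ altChains C a b ∅ s ∧
      (walkEdges p ∩ edgesAt C z (outColor χ a b z)).card = 1 ∧
      edgesAt C z (outColor χ b a z) ⊆ walkEdges p := by
  obtain ⟨S, hS⟩ := altChains_nonempty (C := C) (a := a) (b := b) (e := s)
    ((eq_or_eq_iff_outColor χ a b z).2 (Or.inl (mem_edgesAt.1 hs).2))
  have hsS := mem_of_mem_altChains hS
  have hmax := hS
  rw [altChains, if_neg (hcyc s hs)] at hmax
  obtain ⟨x, t, p, hp, rfl⟩ :=
    (Finset.mem_filter.1 hmax).2.2.exists_isMaxDirected (χ := χ) hχ hab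
  have hcount := hp.card_inter hχ hab z
  have hpos : 0 < (walkEdges p ∩ edgesAt C z (outColor χ a b z)).card :=
    Finset.card_pos.2 ⟨s, Finset.mem_inter.2 ⟨hsS, hs⟩⟩
  have hle : (walkEdges p ∩ edgesAt C z (outColor χ a b z)).card ≤ outDeg C χ a b z :=
    Finset.card_le_card Finset.inter_subset_right
  have hle' : (walkEdges p ∩ edgesAt C z (outColor χ b a z)).card ≤ outDeg C χ b a z :=
    Finset.card_le_card Finset.inter_subset_right
  have hone : (walkEdges p ∩ edgesAt C z (outColor χ a b z)).card = 1 := by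
    by_contra hne
    have hzx : z = x := by
      by_contra hzx
      rw [if_neg hzx] at hcount
      omega
    subst hzx
    have hzt : z ≠ t := by
      intro hzt
      rw [if_pos hzt, if_pos rfl] at hcount
      omega
    have hsupp := hp.isDirected.count_support_out hχ hab hp.isTrail z
    rw [if_neg hzt] at hsupp
    obtain ⟨ht, hd⟩ := And.intro hp.isTrail hp.isDirected
    cases p with
    | nil => exact hzt rfl
    | @cons _ w _ h p =>
      rw [SimpleGraph.Walk.support_cons, List.count_cons_self] at hsupp
      have hzp : z ∈ p.support := List.count_pos_iff.1 (by omega)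
      have hcut : SimpleGraph.Walk.cons h p =
          (SimpleGraph.Walk.cons h (p.takeUntil z hzp)).append (p.dropUntil z hzp) := by
        rw [SimpleGraph.Walk.cons_append, SimpleGraph.Walk.take_spec]
      rw [hcut] at ht hd
      refine hcyc ⟨s(z, w), h⟩ (mem_edgesAt.2 ⟨Sym2.mem_mk_left _ _, ?_⟩)
        ⟨_, ?_, (isDirected_append.1 hd).1.isAltCycle hχ hab ht.of_append_left fun v => ?_⟩
      · exact (isDirected_cons.1 (isDirected_append.1 hd).1).1
      · rw [walkEdges_cons]
        exact Finset.mem_insert_self _ _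
      · by_cases hv : v = z
        · exact Or.inr (hv ▸ hz')
        · exact Or.inl (hout v hv)
  refine ⟨x, t, p, hp, hsS, hS, hone, ?_⟩
  by_cases hzx : z = x
  · subst hzx
    exact hp.in_subset
  · rw [if_neg hzx, hone] at hcount
    refine Finset.inter_eq_right.1
      (Finset.eq_of_subset_of_card_le Finset.inter_subset_right ?_)
    change outDeg C χ b a z ≤ _
    split_ifs at hcount <;> omega

/-- If flipping a maximal trail produces a vertex `y` of out-degree two, then the trail ends with a
loop at `y`, and it contains both edges entering `y`. -/
lemma IsMaxDirected.eq_of_one_lt_outDeg_flip (hχ : ∀ u v, G.Adj u v → χ u ≠ χ v) (hab : a ≠ b)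
    {x t : V} {p : G.Walk x t} (hp : IsMaxDirected C χ a b p) {y : V}
    (hout : outDeg C χ a b y ≤ 1) (hin : outDeg C χ b a y ≤ 2)
    (hy : 1 < outDeg (flip C a b (walkEdges p)) χ a b y) :
    y = t ∧ outDeg C χ b a y = 2 ∧ edgesAt C y (outColor χ b a y) ⊆ walkEdges p := by
  have h₁ := hp.card_inter hχ hab y
  have h₂ := outDeg_flip (C := C) χ hab (walkEdges p) y
  have h₅ : (walkEdges p ∩ edgesAt C y (outColor χ b a y)).card ≤ outDeg C χ b a y :=
    Finset.card_le_card Finset.inter_subset_right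
  have h₆ : (walkEdges p ∩ edgesAt C y (outColor χ a b y)).card ≤ outDeg C χ a b y :=
    Finset.card_le_card Finset.inter_subset_right
  by_cases hin' : outDeg C χ b a y ≤ 1
  · exfalso
    rcases hp.inter_eq hχ hab hout hin' with h | h
    · rw [h.1, h.2] at h₂
      omega
    · rw [Finset.inter_eq_right.2 h.1, Finset.inter_eq_right.2 h.2] at h₂
      change _ + outDeg C χ a b y = _ + outDeg C χ b a y at h₂
      omega
  have hyt : y = t := by
    by_contra hyt
    rw [if_neg hyt] at h₁
    split_ifs at h₁ <;> omega
  have h₇ : (walkEdges p ∩ edgesAt C y (outColor χ a b y)).card = outDeg C χ a b y := by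
    subst hyt
    rw [Finset.inter_eq_right.2 hp.out_subset, outDeg]
  rw [if_pos hyt] at h₁
  have h₈ : (walkEdges p ∩ edgesAt C y (outColor χ b a y)).card = 2 := by
    split_ifs at h₁ <;> omega
  refine ⟨hyt, by omega, Finset.inter_eq_right.1
    (Finset.eq_of_subset_of_card_le Finset.inter_subset_right ?_)⟩
  change outDeg C χ b a y ≤ _
  omega

lemma IsMaxDirected.inDeg_flip_le (hχ : ∀ u v, G.Adj u v → χ u ≠ χ v) (hab : a ≠ b)
    {x t : V} {p : G.Walk x t} (hp : IsMaxDirected C χ a b p) {v : V}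
    (hout : outDeg C χ a b v ≤ 1) (hin : outDeg C χ b a v ≤ 2) :
    outDeg (flip C a b (walkEdges p)) χ b a v ≤ 2 ∧
      (outDeg (flip C a b (walkEdges p)) χ b a v = 2 → outDeg C χ b a v = 2) := by
  have h₂ := outDeg_flip' (C := C) χ hab (walkEdges p) v
  by_cases hin' : outDeg C χ b a v ≤ 1
  · rcases hp.inter_eq hχ hab hout hin' with h | h
    · rw [h.1, h.2] at h₂
      omega
    · rw [Finset.inter_eq_right.2 h.1, Finset.inter_eq_right.2 h.2] at h₂
      change _ + outDeg C χ b a v = _ + outDeg C χ a b v at h₂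
      omega
  · have h₁ := hp.card_inter hχ hab v
    have h₃ : (walkEdges p ∩ edgesAt C v (outColor χ a b v)).card ≤ outDeg C χ a b v :=
      Finset.card_le_card Finset.inter_subset_right
    refine ⟨?_, fun _ => by omega⟩
    by_cases hvx : v = x
    · subst hvx
      rw [Finset.inter_eq_right.2 hp.in_subset] at h₂
      change _ + outDeg C χ b a v = _ at h₂
      omega
    · rw [if_neg hvx] at h₁
      split_ifs at h₁ <;> omega

/-- Two maximal trails that pass `z` through different outgoing edges and the same incoming edges
do not both end at a vertex `y` all of whose incoming edges they contain: otherwise no vertex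
would have more incoming than outgoing edges in the difference of the two trails, but `z` would
have more outgoing than incoming ones. -/
lemma IsMaxDirected.false_of_common_end (hχ : ∀ u v, G.Adj u v → χ u ≠ χ v) (hab : a ≠ b)
    {x₁ x₂ y z : V} {p₁ : G.Walk x₁ y} {p₂ : G.Walk x₂ y} (hp₁ : IsMaxDirected C χ a b p₁)
    (hp₂ : IsMaxDirected C χ a b p₂) (hout : ∀ v, v ≠ z → outDeg C χ a b v ≤ 1)
    (hin : ∀ v, v ≠ y → outDeg C χ b a v ≤ 1) {s : G.edgeSet}
    (hs : s ∈ edgesAt C z (outColor χ a b z)) (hs₁ : s ∈ walkEdges p₁) (hs₂ : s ∉ walkEdges p₂)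
    (hz : edgesAt C z (outColor χ b a z) ⊆ walkEdges p₂)
    (hy : edgesAt C y (outColor χ b a y) ⊆ walkEdges p₂) : False := by
  set T := walkEdges p₁ \ walkEdges p₂ with hT
  have hcol : ∀ e ∈ T, C e = a ∨ C e = b := fun e he =>
    hp₁.isDirected.color_mem (mem_walkEdges.1 (Finset.mem_sdiff.1 he).1)
  have hempty : ∀ v, edgesAt C v (outColor χ b a v) ⊆ walkEdges p₂ →
      T ∩ edgesAt C v (outColor χ b a v) = ∅ := fun v hsub =>
    Finset.disjoint_iff_inter_eq_empty.1
      (Finset.disjoint_of_subset_right hsub Finset.sdiff_disjoint)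
  have hle : ∀ v, (T ∩ edgesAt C v (outColor χ b a v)).card ≤
      (T ∩ edgesAt C v (outColor χ a b v)).card := by
    intro v
    have hzero : edgesAt C v (outColor χ b a v) ⊆ walkEdges p₂ →
        (T ∩ edgesAt C v (outColor χ b a v)).card ≤
          (T ∩ edgesAt C v (outColor χ a b v)).card := by
      intro hsub
      rw [hempty v hsub]
      exact Nat.zero_le _
    by_cases hvz : v = z
    · exact hzero (hvz ▸ hz)
    by_cases hvy : v = y
    · exact hzero (hvy ▸ hy)
    rcases hp₂.inter_eq hχ hab (hout v hvz) (hin v hvy) with h' | h'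
    · have hrest : ∀ U, walkEdges p₂ ∩ U = ∅ → T ∩ U = walkEdges p₁ ∩ U := by
        intro U hU
        ext e
        have := fun h₁ h₂ => Finset.notMem_empty e (hU ▸ Finset.mem_inter.2 ⟨h₁, h₂⟩)
        simp only [hT, Finset.mem_inter, Finset.mem_sdiff]
        tauto
      rw [hrest _ h'.1, hrest _ h'.2]
      have := hp₁.card_inter hχ hab v
      rw [if_neg hvy] at this
      omega
    · exact hzero h'.2
  have hlt : (T ∩ edgesAt C z (outColor χ b a z)).card <
      (T ∩ edgesAt C z (outColor χ a b z)).card := by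
    rw [hempty z hz, Finset.card_empty, Finset.card_pos]
    exact ⟨s, Finset.mem_inter.2 ⟨Finset.mem_sdiff.2 ⟨hs₁, hs₂⟩, hs⟩⟩
  have hsum := Finset.sum_lt_sum (fun v _ => hle v) ⟨z, Finset.mem_univ z, hlt⟩
  rw [sum_card_inter_edgesAt hχ hab hcol,
    sum_card_inter_edgesAt hχ hab.symm fun e he => (hcol e he).symm] at hsum
  exact lt_irrefl _ hsum

/-- Let `z` be the only vertex of out-degree two and let there be at most one vertex of in-degree
two.  Then one of the alternating cycles or maximal alternating trails through the edges leaving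
`z` passes `z` exactly once, and flipping it creates no further vertices of out-degree or
in-degree two. -/
lemma exists_mem_altChains (hχ : ∀ u v, G.Adj u v → χ u ≠ χ v) (hab : a ≠ b) {z : V}
    (hz : outDeg C χ a b z = 2) (hz' : outDeg C χ b a z ≤ 1)
    (hout : ∀ v, v ≠ z → outDeg C χ a b v ≤ 1) (hin : ∀ v, outDeg C χ b a v ≤ 2)
    (hunique : ∀ v w, outDeg C χ b a v = 2 → outDeg C χ b a w = 2 → v = w) :
    ∃ s ∈ edgesAt C z (outColor χ a b z), ∃ S ∈ altChains C a b ∅ s,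
      (S ∩ edgesAt C z (outColor χ a b z)).card = 1 ∧ edgesAt C z (outColor χ b a z) ⊆ S ∧
      (∀ v, v ≠ z → outDeg (flip C a b S) χ a b v ≤ 1) ∧
      ∀ v, v ≠ z → outDeg (flip C a b S) χ b a v ≤ 2 ∧
        (outDeg (flip C a b S) χ b a v = 2 → outDeg C χ b a v = 2) := by
  by_cases hcyc : ∃ s ∈ edgesAt C z (outColor χ a b z), ∃ S, s ∈ S ∧ IsAltCycle C a b ∅ S
  · obtain ⟨s, hs, hS⟩ := hcyc
    obtain ⟨S, hsS, hScyc⟩ := id hS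
    have hcount := hScyc.card_inter hχ hab
    have h₁ : ∀ v, outDeg (flip C a b S) χ a b v = outDeg C χ a b v := fun v => by
      have h₁ := outDeg_flip (C := C) χ hab S v
      have h₂ := hcount v
      omega
    have h₂ : ∀ v, outDeg (flip C a b S) χ b a v = outDeg C χ b a v := fun v => by
      have h₁ := outDeg_flip' (C := C) χ hab S v
      have h₂ := hcount v
      omega
    have hpos : 0 < (S ∩ edgesAt C z (outColor χ a b z)).card :=
      Finset.card_pos.2 ⟨s, Finset.mem_inter.2 ⟨hsS, hs⟩⟩
    have hle : (S ∩ edgesAt C z (outColor χ b a z)).card ≤ outDeg C χ b a z :=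
      Finset.card_le_card Finset.inter_subset_right
    have hz'' := hcount z
    refine ⟨s, hs, S, ?_, by omega, ?_, fun v hv => by rw [h₁]; exact hout v hv,
      fun v _ => by rw [h₂]; exact ⟨hin v, id⟩⟩
    · rw [altChains, if_pos hS]
      exact Finset.mem_filter.2 ⟨Finset.mem_univ _, hsS, hScyc⟩
    · refine Finset.inter_eq_right.1
        (Finset.eq_of_subset_of_card_le Finset.inter_subset_right ?_)
      change outDeg C χ b a z ≤ _
      omega
  · push Not at hcyc
    have hcyc' : ∀ s ∈ edgesAt C z (outColor χ a b z), ¬ ∃ S, s ∈ S ∧ IsAltCycle C a b ∅ S :=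
      fun s hs ⟨S, hS⟩ => hcyc s hs S hS.1 hS.2
    obtain ⟨s₁, s₂, hne, hpair⟩ := Finset.card_eq_two.1 hz
    have hs₁ : s₁ ∈ edgesAt C z (outColor χ a b z) := by simp [hpair]
    have hs₂ : s₂ ∈ edgesAt C z (outColor χ a b z) := by simp [hpair]
    obtain ⟨x₁, t₁, p₁, hp₁, hm₁, hch₁, hone₁, hin₁⟩ :=
      exists_isMaxDirected_of_not_cycle hχ hab hz hz' hout hcyc' hs₁
    obtain ⟨x₂, t₂, p₂, hp₂, hm₂, hch₂, hone₂, hin₂⟩ :=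
      exists_isMaxDirected_of_not_cycle hχ hab hz hz' hout hcyc' hs₂
    by_cases hg₁ : ∀ v, v ≠ z → outDeg (flip C a b (walkEdges p₁)) χ a b v ≤ 1
    · exact ⟨s₁, hs₁, _, hch₁, hone₁, hin₁, hg₁,
        fun v hv => hp₁.inDeg_flip_le hχ hab (hout v hv) (hin v)⟩
    by_cases hg₂ : ∀ v, v ≠ z → outDeg (flip C a b (walkEdges p₂)) χ a b v ≤ 1
    · exact ⟨s₂, hs₂, _, hch₂, hone₂, hin₂, hg₂,
        fun v hv => hp₂.inDeg_flip_le hχ hab (hout v hv) (hin v)⟩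
    exfalso
    push Not at hg₁ hg₂
    obtain ⟨y₁, hy₁, hb₁⟩ := hg₁
    obtain ⟨y₂, hy₂, hb₂⟩ := hg₂
    obtain ⟨rfl, hd₁, -⟩ := hp₁.eq_of_one_lt_outDeg_flip hχ hab (hout _ hy₁) (hin _) hb₁
    obtain ⟨rfl, hd₂, hsub₂⟩ := hp₂.eq_of_one_lt_outDeg_flip hχ hab (hout _ hy₂) (hin _) hb₂
    obtain rfl := hunique _ _ hd₁ hd₂
    refine hp₁.false_of_common_end hχ hab hp₂ hout (fun v hv => ?_) hs₁ hm₁ (fun hmem => hne ?_)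
      hin₂ hsub₂
    · have := hin v
      have : outDeg C χ b a v ≠ 2 := fun h => hv (hunique _ _ h hd₁)
      omega
    · exact Finset.card_le_one.1 hone₂.le _ (Finset.mem_inter.2 ⟨hmem, hs₁⟩) _
        (Finset.mem_inter.2 ⟨hm₂, hs₂⟩)

end TwoColorMoves

section ThreeColorMoves

variable {V : Type*} [Fintype V] {G : SimpleGraph V} {k : ℕ}
  {C D : G.EdgeLabeling (Fin k)} {χ : V → Bool} {a b c d : Fin k}

/-! ### Labelings with one repeated color -/

/-- A labeling that is proper except that, on each side of the bipartition `χ`, at most one vertex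
has a `(+a-c)`-deficiency. -/
structure OnlyRepeats (D : G.EdgeLabeling (Fin k)) (χ : V → Bool) (a c : Fin k) : Prop where
  card_le_one : ∀ v x, x ≠ a → (edgesAt D v x).card ≤ 1
  card_le_two : ∀ v, (edgesAt D v a).card ≤ 2
  missing : ∀ v, (edgesAt D v a).card = 2 → (edgesAt D v c).card = 0
  unique : ∀ v w, (edgesAt D v a).card = 2 → (edgesAt D w a).card = 2 → χ v = χ w → v = w

lemma outDeg_of_true {v : V} (h : χ v = true) : outDeg D χ a c v = (edgesAt D v a).card := by
  rw [outDeg, outColor, if_pos h]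

lemma outDeg_of_false {v : V} (h : χ v = false) : outDeg D χ a c v = (edgesAt D v c).card := by
  rw [outDeg, outColor, if_neg (by simp [h])]

lemma OnlyRepeats.not (h : OnlyRepeats D χ a c) : OnlyRepeats D (fun v => !χ v) a c :=
  ⟨h.card_le_one, h.card_le_two, h.missing, fun v w hv hw hvw =>
    h.unique v w hv hw (Bool.not_inj hvw)⟩

lemma OnlyRepeats.isNearProper (hac : a ≠ c) (h : OnlyRepeats D χ a c) :
    IsNearProper D χ a c := by
  refine ⟨fun v x ha _ => h.card_le_one v x ha, fun v => ?_, fun u v hu hv => ?_,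
    fun u v hu hv => ?_⟩
  · have h₁ := h.card_le_one v c hac.symm
    have h₂ := h.card_le_two v
    have h₃ := h.missing v
    cases hv : χ v
    · rw [outDeg_of_false hv, outDeg_of_false hv]
      omega
    · rw [outDeg_of_true hv, outDeg_of_true hv]
      omega
  · have side : ∀ v, outDeg D χ a c v = 2 → χ v = true ∧ (edgesAt D v a).card = 2 := by
      intro v hv
      cases hχv : χ v
      · rw [outDeg_of_false hχv] at hv
        have := h.card_le_one v c hac.symm
        omega
      · exact ⟨rfl, outDeg_of_true hχv ▸ hv⟩
    exact h.unique u v (side u hu).2 (side v hv).2 ((side u hu).1.trans (side v hv).1.symm)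
  · have side : ∀ v, outDeg D χ c a v = 2 → χ v = false ∧ (edgesAt D v a).card = 2 := by
      intro v hv
      cases hχv : χ v
      · exact ⟨rfl, outDeg_of_false hχv ▸ hv⟩
      · rw [outDeg_of_true hχv] at hv
        have := h.card_le_one v c hac.symm
        omega
    exact h.unique u v (side u hu).2 (side v hv).2 ((side u hu).1.trans (side v hv).1.symm)

lemma IsNearProper.onlyRepeats (h : IsNearProper D χ a c)
    (hc : ∀ v, (edgesAt D v c).card ≤ 1) : OnlyRepeats D χ a c := by
  refine ⟨fun v x hx => ?_, fun v => ?_, fun v hv => ?_, fun v w hv hw hvw => ?_⟩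
  · by_cases hxc : x = c
    · exact hxc ▸ hc v
    · exact h.other v x hx hxc
  · have h₁ := h.degrees v
    cases hv : χ v
    · rw [outDeg_of_false hv, outDeg_of_false hv] at h₁
      omega
    · rw [outDeg_of_true hv, outDeg_of_true hv] at h₁
      omega
  · have h₁ := h.degrees v
    cases hv : χ v
    · rw [outDeg_of_false hv, outDeg_of_false hv] at h₁
      omega
    · rw [outDeg_of_true hv, outDeg_of_true hv] at h₁
      omega
  · cases hχv : χ v
    · have hχw : χ w = false := hvw ▸ hχv
      exact h.sink_unique v w ((outDeg_of_false hχv).trans hv) ((outDeg_of_false hχw).trans hw)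
    · have hχw : χ w = true := hvw ▸ hχv
      exact h.source_unique v w ((outDeg_of_true hχv).trans hv) ((outDeg_of_true hχw).trans hw)

lemma OnlyRepeats.hasDeficiency (h : OnlyRepeats D χ a c) {v : V}
    (hv : (edgesAt D v a).card = 2) : HasDeficiency D v a c :=
  ⟨hv, h.card_le_one v, Finset.card_eq_zero.1 (h.missing v hv)⟩

lemma OnlyRepeats.mem_deficient_iff (h : OnlyRepeats D χ a c) {v : V} :
    v ∈ deficient D ↔ (edgesAt D v a).card = 2 := by
  constructor
  · intro hv
    obtain ⟨x, x', hx, -⟩ := mem_deficient.1 hv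
    by_cases hxa : x = a
    · exact hxa ▸ hx
    · have := h.card_le_one v x hxa
      omega
  · intro hv
    exact mem_deficient.2 ⟨a, c, hv, h.card_le_one v, Finset.card_eq_zero.1 (h.missing v hv)⟩

lemma OnlyRepeats.isProper (h : OnlyRepeats D χ a c) (h' : ∀ v, (edgesAt D v a).card ≠ 2) :
    IsProper D := by
  rw [isProper_iff_card_edgesAt_le_one]
  intro v x
  by_cases hx : x = a
  · subst hx
    have h₁ := h.card_le_two v
    have h₂ := h' v
    omega
  · exact h.card_le_one v x hx

/-- Flip a suitable alternating cycle or maximal alternating trail of the repeated color `a` and a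
third color `d` at a deficient vertex `z`: if `z` has an edge of color `d`, then this edge becomes
a repeated edge, and otherwise the deficiency of `z` disappears. -/
lemma OnlyRepeats.exists_flip (hχ : ∀ u v, G.Adj u v → χ u ≠ χ v) (hac : a ≠ c)
    (h : OnlyRepeats D χ a c) (hda : d ≠ a) (hdc : d ≠ c) {z : V}
    (hz : (edgesAt D z a).card = 2) :
    ∃ s ∈ edgesAt D z a, ∃ S ∈ altChains D a d ∅ s,
      OnlyRepeats (flip D a d S) χ a c ∧
      (edgesAt (flip D a d S) z a).card = 1 + (edgesAt D z d).card ∧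
      edgesAt D z d ⊆ edgesAt (flip D a d S) z a ∧
      ∀ v, v ≠ z → (edgesAt (flip D a d S) v a).card = 2 → (edgesAt D v a).card = 2 := by
  -- On the side `true` the edges of color `a` leave `z` in the orientation by `a` and `d`.
  wlog hzχ : χ z = true generalizing χ
  · obtain ⟨s, hs, S, hS, h₁, h₂⟩ := this (χ := fun v => !χ v)
      (fun u v huv heq => hχ u v huv (Bool.not_inj heq)) h.not (by simpa using hzχ)
    exact ⟨s, hs, S, hS, by simpa using h₁.not, h₂⟩
  have hd : ∀ v, (edgesAt D v d).card ≤ 1 := fun v => h.card_le_one v d hda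
  have hcases : ∀ v, χ v = true ∧ outDeg D χ a d v = (edgesAt D v a).card ∧
      outDeg D χ d a v = (edgesAt D v d).card ∨
      χ v = false ∧ outDeg D χ a d v = (edgesAt D v d).card ∧
        outDeg D χ d a v = (edgesAt D v a).card := by
    intro v
    cases hv : χ v
    · exact Or.inr ⟨rfl, outDeg_of_false hv, outDeg_of_false hv⟩
    · exact Or.inl ⟨rfl, outDeg_of_true hv, outDeg_of_true hv⟩
  have ho : outColor χ a d z = a := by rw [outColor, if_pos hzχ]
  have hi : outColor χ d a z = d := by rw [outColor, if_pos hzχ]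
  obtain ⟨s, hs, S, hS, hone, hsub, hout, hin⟩ := exists_mem_altChains (C := D) hχ hda.symm
    (z := z) (by rw [outDeg_of_true hzχ, hz]) (by rw [outDeg_of_true hzχ]; exact hd z)
    (fun v hv => by
      rcases hcases v with h' | h'
      · have h₁ : (edgesAt D v a).card ≠ 2 := fun h₁ =>
          hv (h.unique v z h₁ hz (h'.1.trans hzχ.symm))
        have := h.card_le_two v
        omega
      · have := hd v
        omega)
    (fun v => by
      have h₁ := hd v
      have h₂ := h.card_le_two v
      rcases hcases v with h' | h' <;> omega)
    (fun v w hv hw => by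
      have h₁ := hd v
      have h₂ := hd w
      rcases hcases v with h' | h' <;> rcases hcases w with h'' | h''
      · omega
      · omega
      · omega
      · exact h.unique v w (by omega) (by omega) (h'.1.trans h''.1.symm))
  rw [ho] at hs hone
  rw [hi] at hsub
  set D' := flip D a d S with hD'
  have hcases' : ∀ v, χ v = true ∧ outDeg D' χ a d v = (edgesAt D' v a).card ∧
      outDeg D' χ d a v = (edgesAt D' v d).card ∨
      χ v = false ∧ outDeg D' χ a d v = (edgesAt D' v d).card ∧
        outDeg D' χ d a v = (edgesAt D' v a).card := by
    intro v
    cases hv : χ v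
    · exact Or.inr ⟨rfl, outDeg_of_false hv, outDeg_of_false hv⟩
    · exact Or.inl ⟨rfl, outDeg_of_true hv, outDeg_of_true hv⟩
  have hza := card_edgesAt_flip_left (C := D) (S := S) z hda.symm
  have hzd := card_edgesAt_flip_right (C := D) (S := S) z hda.symm
  rw [hone, Finset.inter_eq_right.2 hsub, ← hD'] at hza hzd
  have hrep : ∀ v, v ≠ z → (edgesAt D' v a).card = 2 → (edgesAt D v a).card = 2 := by
    intro v hv hv2
    have h₁ := hout v hv
    have h₂ := hin v hv
    have h₃ := hd v
    rcases hcases v with h' | h' <;> rcases hcases' v with h'' | h''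
    · omega
    · exact absurd (h'.1.symm.trans h''.1) (by simp)
    · exact absurd (h'.1.symm.trans h''.1) (by simp)
    · omega
  have hcard : ∀ v, (edgesAt D' v a).card ≤ 2 ∧ (edgesAt D' v d).card ≤ 1 := by
    intro v
    by_cases hv : v = z
    · subst hv
      have := hd v
      omega
    · have h₁ := hout v hv
      have h₂ := hin v hv
      have h₃ := hd v
      rcases hcases v with h' | h' <;> rcases hcases' v with h'' | h''
      · omega
      · exact absurd (h'.1.symm.trans h''.1) (by simp)
      · exact absurd (h'.1.symm.trans h''.1) (by simp)
      · omega
  have hc : ∀ v x, x ≠ a → x ≠ d → edgesAt D' v x = edgesAt D v x := fun v x ha hd =>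
    edgesAt_flip_of_ne ha hd
  have hrep' : ∀ v, (edgesAt D' v a).card = 2 → (edgesAt D v a).card = 2 := fun v hv => by
    by_cases hvz : v = z
    · exact hvz ▸ hz
    · exact hrep v hvz hv
  have hrepeats : OnlyRepeats D' χ a c := by
    refine ⟨fun v x hx => ?_, fun v => (hcard v).1, fun v hv => ?_,
      fun v w hv hw => h.unique v w (hrep' v hv) (hrep' w hw)⟩
    · by_cases hxd : x = d
      · exact hxd ▸ (hcard v).2
      · rw [hc v x hx hxd]
        exact h.card_le_one v x hx
    · rw [hc v c hac.symm hdc.symm]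
      exact h.missing v (hrep' v hv)
  have hza' : (edgesAt D' z a).card = 1 + (edgesAt D z d).card := by omega
  refine ⟨s, hs, S, hS, hrepeats, hza', ?_, hrep⟩
  intro e he
  have he' := mem_edgesAt.1 he
  refine mem_edgesAt.2 ⟨he'.1, ?_⟩
  rw [flip_apply_of_mem _ _ _ _ (hsub he), he'.2, Equiv.swap_apply_right]

/-- A three-color move can carry out the flip of `OnlyRepeats.exists_flip` on a hidden
labeling. -/
lemma Resolves.exists_move_third_color (hχ : ∀ u v, G.Adj u v → χ u ≠ χ v) (hac : a ≠ c)
    (hCD : Resolves a c C D) (h : OnlyRepeats D χ a c) (hda : d ≠ a) (hdc : d ≠ c) {z : V}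
    (hz : (edgesAt D z a).card = 2) :
    ∃ C' ∈ (move C).support, ∃ S, Resolves a c C' (flip D a d S) ∧
      OnlyRepeats (flip D a d S) χ a c ∧
      (edgesAt (flip D a d S) z a).card = 1 + (edgesAt D z d).card ∧
      edgesAt D z d ⊆ edgesAt (flip D a d S) z a ∧
      ∀ v, v ≠ z → (edgesAt (flip D a d S) v a).card = 2 → (edgesAt D v a).card = 2 := by
  obtain ⟨s, hs, S, hS, hrep, hrest⟩ := h.exists_flip hχ hac hda hdc hz
  obtain ⟨C', hC', hres⟩ :=
    (hrep.isNearProper hac).exists_resolves hχ hac (K := {a, c, d}) (by simp) (by simp)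
  refine ⟨C', mem_support_threeColorMove hac hda hdc ?_, S, hres, hrep, hrest⟩
  rw [threeColorMove, PMF.mem_support_bind_iff]
  refine ⟨_, (PMF.mem_support_bind_iff ..).2 ⟨D, hCD.mem_support, ?_⟩, hC'⟩
  have hdef : z ∈ deficient D := h.mem_deficient_iff.2 hz
  have hs' := mem_edgesAt.1 hs
  have hflip : flip D a d S ∈ (deficientFlip d D).support := by
    rw [deficientFlip]
    refine mem_support_pick hdef ?_
    refine mem_support_pick (x := s) ?_ ?_
    · simp only [repeatedEdges, Finset.mem_filter, Finset.mem_univ, true_and]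
      exact ⟨hs'.1, c, hs'.2 ▸ h.hasDeficiency hz⟩
    · rw [hs'.2]
      exact mem_support_pick hS (by simp)
  have hcard : (deficient D).card ≠ 0 := (Finset.card_pos.2 ⟨z, hdef⟩).ne'
  rw [thirdColorFlip, if_neg hcard]
  split_ifs
  exacts [mem_support_coin_left hflip, hflip]

/-! ### Flipping one edge -/

lemma card_edgesAt_flip_singleton (hac : a ≠ c) {e : G.edgeSet} (he : D e = a) (v : V) :
    (edgesAt (flip D a c {e}) v a).card + (if v ∈ (e : Sym2 V) then 1 else 0) =
        (edgesAt D v a).card ∧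
      (edgesAt (flip D a c {e}) v c).card =
        (edgesAt D v c).card + (if v ∈ (e : Sym2 V) then 1 else 0) := by
  have h₁ := card_edgesAt_flip_left (C := D) (S := {e}) v hac
  have h₂ := card_edgesAt_flip_right (C := D) (S := {e}) v hac
  have h₃ : e ∈ edgesAt D v a ↔ v ∈ (e : Sym2 V) := by simp [mem_edgesAt, he]
  have h₄ : e ∉ edgesAt D v c := by simp [mem_edgesAt, he, hac]
  simp only [card_singleton_inter, h₃, if_neg h₄] at h₁ h₂
  exact ⟨h₁, h₂⟩

/-- A two-color move can flip a repeated edge of a hidden nearly proper labeling. -/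
lemma Resolves.exists_move_flip_repeated (hχ : ∀ u v, G.Adj u v → χ u ≠ χ v) (hac : a ≠ c)
    (hCD : Resolves a c C D) (h : IsNearProper D χ a c) {x : Fin k} (hx : x = a ∨ x = c) {u : V}
    (hu : (edgesAt D u x).card = 2) {g : G.edgeSet} (hg : g ∈ edgesAt D u x) :
    IsNearProper (flip D a c {g}) χ a c ∧
      ∃ C' ∈ (move C).support, Resolves a c C' (flip D a c {g}) := by
  rcases (eq_or_eq_iff_outColor χ a c u).1 hx with rfl | rfl
  · exact ⟨h.flip_singleton hχ hac hu hg, hCD.exists_move_flip_singleton hχ hac h hu hg⟩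
  · rw [flip_colors_comm]
    obtain ⟨C', hC', hres⟩ :=
      (resolves_comm.1 hCD).exists_move_flip_singleton hχ hac.symm h.symm hu hg
    exact ⟨(h.symm.flip_singleton hχ hac.symm hu hg).symm, C', hC', resolves_comm.1 hres⟩

end ThreeColorMoves

section Progress

variable {V : Type*} {G : SimpleGraph V} {k : ℕ}
  {C D T : G.EdgeLabeling (Fin k)} {χ : V → Bool} {a b c d : Fin k} {L : Finset (Fin k)}

/-! ### Progress in one color class -/

/-- An edge whose color in one of the labelings `D` and `T` is outside `L` has the same color in
both of them. -/
def AgreeOutside (L : Finset (Fin k)) (D T : G.EdgeLabeling (Fin k)) : Prop :=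
  ∀ e, D e ∉ L ∨ T e ∉ L → D e = T e

lemma AgreeOutside.mem_iff (h : AgreeOutside L D T) (e : G.edgeSet) : D e ∈ L ↔ T e ∈ L := by
  constructor
  · intro hD
    by_contra hT
    exact hT (h e (Or.inr hT) ▸ hD)
  · intro hT
    by_contra hD
    exact hD (h e (Or.inl hD) ▸ hT)

lemma AgreeOutside.flip (h : AgreeOutside L D T) (ha : a ∈ L) (hb : b ∈ L)
    (S : Finset G.edgeSet) : AgreeOutside L (flip D a b S) T := by
  intro e he
  by_cases hea : D e = a
  · have hT := (h.mem_iff e).1 (hea ▸ ha)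
    have hF : BipartiteEdgeColoring.flip D a b S e ∈ L := by
      by_cases heS : e ∈ S
      · rw [flip_apply_of_mem _ _ _ _ heS, hea, Equiv.swap_apply_left]
        exact hb
      · rw [flip_apply_of_notMem _ _ _ _ heS, hea]
        exact ha
    tauto
  by_cases heb : D e = b
  · have hT := (h.mem_iff e).1 (heb ▸ hb)
    have hF : BipartiteEdgeColoring.flip D a b S e ∈ L := by
      by_cases heS : e ∈ S
      · rw [flip_apply_of_mem _ _ _ _ heS, heb, Equiv.swap_apply_right]
        exact ha
      · rw [flip_apply_of_notMem _ _ _ _ heS, heb]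
        exact hb
    tauto
  · rw [flip_apply_eq_of_ne hea heb] at he ⊢
    exact h e he

variable [Fintype V]

/-- A number of steps that suffices to make the color class `c` of `D` equal to the one of the
target `T`: one for each edge that should have color `c`, two for each edge of color `c` that
should have another color, and one for each deficient vertex. -/
def excess (D T : G.EdgeLabeling (Fin k)) (c : Fin k) : ℕ :=
  (Finset.univ.filter fun e => T e = c ∧ D e ≠ c).card +
    2 * (Finset.univ.filter fun e => D e = c ∧ T e ≠ c).card + (deficient D).card

/-- The labeling `D` can be reached from `C` in `n` steps through edge colorings. -/
inductive ReachesIn : ℕ → G.EdgeLabeling (Fin k) → G.EdgeLabeling (Fin k) → Prop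
  | refl (C : G.EdgeLabeling (Fin k)) : ReachesIn 0 C C
  | step {n : ℕ} {C D E : G.EdgeLabeling (Fin k)} :
    D ∈ (move C).support → IsProper D → ReachesIn n D E → ReachesIn (n + 1) C E

lemma ReachesIn.trans {m n : ℕ} {E : G.EdgeLabeling (Fin k)} (h₁ : ReachesIn m C D)
    (h₂ : ReachesIn n D E) : ReachesIn (m + n) C E := by
  induction h₁ with
  | refl => rwa [Nat.zero_add]
  | @step m _ _ _ hD hp _ ih =>
    rw [Nat.add_right_comm]
    exact .step hD hp (ih h₂)

lemma ReachesIn.single (hD : D ∈ (move C).support) (h : IsProper D) : ReachesIn 1 C D :=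
  .step hD h (.refl D)

lemma IsProper.eq_of_mem (h : IsProper T) {v : V} {e f : G.edgeSet} (he : v ∈ (e : Sym2 V))
    (hf : v ∈ (f : Sym2 V)) (hef : T e = T f) : e = f :=
  Finset.card_le_one.1 (isProper_iff_card_edgesAt_le_one.1 h v (T f)) e
    (mem_edgesAt.2 ⟨he, hef⟩) f (mem_edgesAt.2 ⟨hf, rfl⟩)

/-- If the edge at a deficient vertex `z` that should have color `c` is one of the repeated edges
of `z`, then it receives the color `c`; an edge of color `c` adjacent to it at its other end
receives the repeated color. -/
lemma OnlyRepeats.exists_recolor (hχ : ∀ u v, G.Adj u v → χ u ≠ χ v) (hac : a ≠ c)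
    (hT : IsProper T) (hCD : Resolves a c C D) (h : OnlyRepeats D χ a c)
    {z : V} (hz : (edgesAt D z a).card = 2) {e : G.edgeSet} (he : e ∈ edgesAt D z a)
    (hTe : T e = c) :
    ∃ n C' D', ReachesIn n C C' ∧ Resolves a c C' D' ∧ OnlyRepeats D' χ a c ∧
      (∀ L, a ∈ L → c ∈ L → AgreeOutside L D T → AgreeOutside L D' T) ∧
      n + 1 + excess D' T c ≤ excess D T c := by
  obtain ⟨w, hzw, rfl⟩ := exists_adj_of_mem_edgesAt he
  set e : G.edgeSet := ⟨s(z, w), hzw⟩ with he_def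
  have hDe : D e = a := (mem_edgesAt.1 he).2
  have hve : ∀ v, v ∈ (e : Sym2 V) ↔ v = z ∨ v = w := fun v => Sym2.mem_iff
  have hzw' : z ≠ w := hzw.ne
  have hz0 := h.missing z hz
  obtain ⟨hnear, C₁, hC₁, hres₁⟩ :=
    hCD.exists_move_flip_repeated hχ hac (h.isNearProper hac) (Or.inl rfl) hz he
  set D₁ := BipartiteEdgeColoring.flip D a c {e} with hD₁
  have key := card_edgesAt_flip_singleton (D := D) hac hDe
  rw [← hD₁] at key
  have hD₁e : D₁ e = c := by
    rw [hD₁, flip_apply_of_mem _ _ _ _ (Finset.mem_singleton_self e), hDe, Equiv.swap_apply_left]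
  have hD₁f : ∀ f, f ≠ e → D₁ f = D f := fun f hf =>
    flip_apply_of_notMem _ _ _ _ (by simpa using hf)
  have hmissing : (Finset.univ.filter fun f => T f = c ∧ D f ≠ c).card =
      (Finset.univ.filter fun f => T f = c ∧ D₁ f ≠ c).card + 1 := by
    have : (Finset.univ.filter fun f => T f = c ∧ D f ≠ c) =
        insert e (Finset.univ.filter fun f => T f = c ∧ D₁ f ≠ c) := by
      ext f
      by_cases hf : f = e
      · simp [hf, hTe, hDe, hac]
      · simp [hf, hD₁f f hf]
    rw [this, Finset.card_insert_of_notMem (by simp [hD₁e])]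
  have hsurplus : (Finset.univ.filter fun f => D₁ f = c ∧ T f ≠ c) =
      (Finset.univ.filter fun f => D f = c ∧ T f ≠ c) := by
    ext f
    by_cases hf : f = e
    · simp [hf, hTe]
    · simp [hD₁f f hf]
  by_cases hw : (edgesAt D w c).card = 0
  · -- The other end of the edge misses `c`: no further edge has to be changed.
    have hrep : OnlyRepeats D₁ χ a c := hnear.onlyRepeats fun v => by
      have h₁ := (key v).2
      have h₂ := h.card_le_one v c hac.symm
      by_cases hv : v = z ∨ v = w
      · rw [if_pos ((hve v).2 hv)] at h₁
        rcases hv with rfl | rfl <;> omega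
      · rw [if_neg ((hve v).not.2 hv)] at h₁
        omega
    refine ⟨1, C₁, D₁, .single hC₁ hres₁.isProper, hres₁, hrep,
      fun L ha hc hL => hL.flip ha hc _, ?_⟩
    have hdef : (deficient D₁).card ≤ (deficient D).card - 1 := by
      rw [← Finset.card_erase_of_mem (h.mem_deficient_iff.2 hz)]
      refine Finset.card_le_card fun v hv => ?_
      have hv' := hrep.mem_deficient_iff.1 hv
      have h₁ := (key v).1
      have h₂ := h.card_le_two v
      rw [Finset.mem_erase, h.mem_deficient_iff]
      split_ifs at h₁ with hmem
      · omega
      · refine ⟨fun hvz => hmem ((hve v).2 (Or.inl hvz)), by omega⟩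
    have hpos : 0 < (deficient D).card :=
      Finset.card_pos.2 ⟨z, h.mem_deficient_iff.2 hz⟩
    unfold excess
    rw [hsurplus]
    omega
  · -- Now the other end has two edges of color `c`, and the second one is flipped as well.
    obtain ⟨f, hf⟩ := Finset.card_pos.1 (Nat.pos_of_ne_zero hw)
    have hfe : f ≠ e := by
      rintro rfl
      exact hac (hDe.symm.trans (mem_edgesAt.1 hf).2)
    have hf₁ : f ∈ edgesAt D₁ w c :=
      mem_edgesAt.2 ⟨(mem_edgesAt.1 hf).1, (hD₁f f hfe).trans (mem_edgesAt.1 hf).2⟩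
    have hw1 : (edgesAt D w c).card = 1 := by
      have := h.card_le_one w c hac.symm
      omega
    have hw2 : (edgesAt D₁ w c).card = 2 := by
      have h₁ := (key w).2
      rw [if_pos ((hve w).2 (Or.inr rfl))] at h₁
      omega
    obtain ⟨hnear₂, C₂, hC₂, hres₂⟩ :=
      hres₁.exists_move_flip_repeated hχ hac hnear (Or.inr rfl) hw2 hf₁
    obtain ⟨z', hwz', rfl⟩ := exists_adj_of_mem_edgesAt hf
    set f : G.edgeSet := ⟨s(w, z'), hwz'⟩ with hf_def
    have hvf : ∀ v, v ∈ (f : Sym2 V) ↔ v = w ∨ v = z' := fun v => Sym2.mem_iff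
    have hDf : D f = c := (mem_edgesAt.1 hf).2
    have hD₁fc : D₁ f = c := (hD₁f f hfe).trans hDf
    have hTf : T f ≠ c := fun hTf =>
      hfe (hT.eq_of_mem (v := w) ((hvf w).2 (Or.inl rfl)) ((hve w).2 (Or.inr rfl))
        (hTf.trans hTe.symm))
    have key₂ := card_edgesAt_flip_singleton (D := D₁) hac.symm hD₁fc
    rw [flip_colors_comm] at key₂
    set D₂ := BipartiteEdgeColoring.flip D₁ a c {f} with hD₂
    have hD₂f : D₂ f = a := by
      rw [hD₂, flip_apply_of_mem _ _ _ _ (Finset.mem_singleton_self f), hD₁fc,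
        Equiv.swap_apply_right]
    have hD₂g : ∀ g, g ≠ f → D₂ g = D₁ g := fun g hg =>
      flip_apply_of_notMem _ _ _ _ (by simpa using hg)
    have hzz' : z ≠ z' := by
      rintro rfl
      have : f ∈ edgesAt D z c := mem_edgesAt.2 ⟨(hvf z).2 (Or.inr rfl), hDf⟩
      rw [Finset.card_eq_zero.1 hz0] at this
      exact Finset.notMem_empty _ this
    have hrep : OnlyRepeats D₂ χ a c := hnear₂.onlyRepeats fun v => by
      have h₁ := (key v).2
      have h₂ := (key₂ v).1
      have h₃ := h.card_le_one v c hac.symm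
      by_cases hvz : v = z
      · rw [if_pos ((hve v).2 (Or.inl hvz)), hvz, hz0] at h₁
        rw [hvz] at h₂ ⊢
        split_ifs at h₂ <;> omega
      by_cases hvw : v = w
      · rw [if_pos ((hve v).2 (Or.inr hvw))] at h₁
        rw [if_pos ((hvf v).2 (Or.inl hvw))] at h₂
        omega
      · rw [if_neg ((hve v).not.2 (by tauto))] at h₁
        split_ifs at h₂ <;> omega
    refine ⟨2, C₂, D₂, .step hC₁ hres₁.isProper (.single hC₂ hres₂.isProper), hres₂, hrep,
      fun L ha hc hL => (hL.flip ha hc _).flip ha hc _, ?_⟩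
    have hdef : (deficient D₂).card ≤ (deficient D).card := by
      have hpos : 0 < (deficient D).card :=
        Finset.card_pos.2 ⟨z, h.mem_deficient_iff.2 hz⟩
      have hsub : deficient D₂ ⊆ insert z' ((deficient D).erase z) := by
        intro v hv
        have hv' := hrep.mem_deficient_iff.1 hv
        have h₁ := (key v).1
        have h₂ := (key₂ v).2
        have h₃ := h.card_le_two v
        rw [Finset.mem_insert, Finset.mem_erase, h.mem_deficient_iff]
        by_cases hvz' : v = z'
        · exact Or.inl hvz'
        by_cases hvz : v = z
        · rw [if_pos ((hve v).2 (Or.inl hvz))] at h₁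
          rw [if_neg ((hvf v).not.2 (by rintro (h | h); exacts [hzw' (hvz ▸ h), hvz' h]))] at h₂
          omega
        refine Or.inr ⟨hvz, ?_⟩
        by_cases hvw : v = w
        · rw [if_pos ((hve v).2 (Or.inr hvw))] at h₁
          rw [if_pos ((hvf v).2 (Or.inl hvw))] at h₂
          omega
        · rw [if_neg ((hve v).not.2 (by tauto))] at h₁
          rw [if_neg ((hvf v).not.2 (by tauto))] at h₂
          omega
      have h₁ := Finset.card_le_card hsub
      have h₂ := Finset.card_insert_le z' ((deficient D).erase z)
      rw [Finset.card_erase_of_mem (h.mem_deficient_iff.2 hz)] at h₂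
      omega
    have hmissing₂ : (Finset.univ.filter fun g => T g = c ∧ D₂ g ≠ c) =
        (Finset.univ.filter fun g => T g = c ∧ D₁ g ≠ c) := by
      ext g
      by_cases hg : g = f
      · simp [hg, hTf]
      · simp [hD₂g g hg]
    have hsurplus₂ : (Finset.univ.filter fun g => D g = c ∧ T g ≠ c).card =
        (Finset.univ.filter fun g => D₂ g = c ∧ T g ≠ c).card + 1 := by
      rw [← hsurplus]
      have : (Finset.univ.filter fun g => D₁ g = c ∧ T g ≠ c) =
          insert f (Finset.univ.filter fun g => D₂ g = c ∧ T g ≠ c) := by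
        ext g
        by_cases hg : g = f
        · simp [hg, hTf, hD₁fc]
        · simp [hg, hD₂g g hg]
      rw [this, Finset.card_insert_of_notMem (by simp [hD₂f, hac])]
    unfold excess
    rw [hmissing₂]
    omega

/-- At a vertex `z` without an edge of color `c` in the target, a `(+a-c)`-deficiency leaves
another color of `L` missing. -/
lemma OnlyRepeats.exists_missing (hT : IsProper T) (h : OnlyRepeats D χ a c)
    (hL : AgreeOutside L D T) (ha : a ∈ L) (hc : c ∈ L) {z : V}
    (hz : (edgesAt D z a).card = 2) (hzT : edgesAt T z c = ∅) (hac : a ≠ c) :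
    ∃ d ∈ L, d ≠ a ∧ d ≠ c ∧ edgesAt D z d = ∅ := by
  by_contra hne
  push Not at hne
  -- Counting the edges at `z` with a color in `L` in both labelings gives a contradiction.
  set E : Finset G.edgeSet := Finset.univ.filter fun e => z ∈ (e : Sym2 V) ∧ T e ∈ L with hE
  have hcard : ∀ X : G.EdgeLabeling (Fin k), (∀ e, X e ∈ L ↔ T e ∈ L) →
      E.card = ∑ x ∈ L, (edgesAt X z x).card := by
    intro X hX
    rw [Finset.card_eq_sum_card_fiberwise (f := X) (t := L)
      fun e he => (hX e).2 (Finset.mem_filter.1 he).2.2]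
    refine Finset.sum_congr rfl fun x hx => congrArg Finset.card ?_
    ext e
    simp only [hE, Finset.mem_filter, Finset.mem_univ, true_and, mem_edgesAt]
    constructor
    · rintro ⟨⟨hz, -⟩, he⟩
      exact ⟨hz, he⟩
    · rintro ⟨hz, rfl⟩
      exact ⟨⟨hz, (hX e).1 hx⟩, rfl⟩
  have h₁ := hcard T fun e => Iff.rfl
  have h₂ := hcard D hL.mem_iff
  have hc' : c ∈ L.erase a := Finset.mem_erase.2 ⟨hac.symm, hc⟩
  rw [← Finset.add_sum_erase L _ ha, ← Finset.add_sum_erase (L.erase a) _ hc'] at h₁ h₂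
  rw [hzT, Finset.card_empty] at h₁
  rw [h.missing z hz, hz] at h₂
  have hTa := isProper_iff_card_edgesAt_le_one.1 hT z a
  have hle : ∑ x ∈ (L.erase a).erase c, (edgesAt T z x).card ≤
      ∑ x ∈ (L.erase a).erase c, (edgesAt D z x).card := by
    refine Finset.sum_le_sum fun x hx => ?_
    simp only [Finset.mem_erase] at hx
    exact (isProper_iff_card_edgesAt_le_one.1 hT z x).trans
      (Finset.card_pos.2 (hne x hx.2.2 hx.2.1 hx.1))
  omega

/-- As long as there is a deficient vertex, a few steps decrease the excess at least by their
number. -/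
lemma OnlyRepeats.exists_progress (hχ : ∀ u v, G.Adj u v → χ u ≠ χ v) (hac : a ≠ c)
    (hT : IsProper T) (hCD : Resolves a c C D) (h : OnlyRepeats D χ a c)
    (hL : AgreeOutside L D T) (ha : a ∈ L) (hc : c ∈ L) {z : V}
    (hz : (edgesAt D z a).card = 2) :
    ∃ n C' D', ReachesIn n C C' ∧ Resolves a c C' D' ∧ OnlyRepeats D' χ a c ∧
      AgreeOutside L D' T ∧ n + excess D' T c ≤ excess D T c ∧
      excess D' T c < excess D T c := by
  have hflip : ∀ {d : Fin k} {S : Finset G.edgeSet}, d ≠ c →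
      OnlyRepeats (BipartiteEdgeColoring.flip D a d S) χ a c →
      ∀ m, (deficient (BipartiteEdgeColoring.flip D a d S)).card + m ≤ (deficient D).card →
      m + excess (BipartiteEdgeColoring.flip D a d S) T c ≤ excess D T c := by
    intro d S hdc _ m hm
    have hiff : ∀ e, BipartiteEdgeColoring.flip D a d S e = c ↔ D e = c := fun e =>
      flip_apply_eq_iff_of_ne hac.symm hdc.symm
    simp only [excess, hiff, ne_eq]
    omega
  have hzc : edgesAt D z c = ∅ := Finset.card_eq_zero.1 (h.missing z hz)
  by_cases hzT : edgesAt T z c = ∅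
  · -- The target has no edge of color `c` at `z`: a flip with a missing third color removes the
    -- deficiency of `z`.
    obtain ⟨d, hd, hda, hdc, hzd⟩ := h.exists_missing hT hL ha hc hz hzT hac
    obtain ⟨C', hC', S, hres, hrep, hcard, -, hdef⟩ :=
      hCD.exists_move_third_color hχ hac h hda hdc hz
    rw [hzd, Finset.card_empty] at hcard
    have hsub : deficient (BipartiteEdgeColoring.flip D a d S) ⊆ (deficient D).erase z := by
      intro v hv
      have hv' := hrep.mem_deficient_iff.1 hv
      have hvz : v ≠ z := by
        rintro rfl
        omega
      exact Finset.mem_erase.2 ⟨hvz, h.mem_deficient_iff.2 (hdef v hvz hv')⟩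
    have hle := Finset.card_le_card hsub
    have hmem := h.mem_deficient_iff.2 hz
    have hpos : 0 < (deficient D).card := Finset.card_pos.2 ⟨z, hmem⟩
    rw [Finset.card_erase_of_mem hmem] at hle
    have := hflip hdc hrep 1 (by omega)
    exact ⟨1, C', _, .single hC' hres.isProper, hres, hrep, hL.flip ha hd S, this, by omega⟩
  · obtain ⟨e, he⟩ := Finset.nonempty_iff_ne_empty.2 hzT
    obtain ⟨hze, hTe⟩ := mem_edgesAt.1 he
    by_cases hDe : D e = a
    · obtain ⟨n, C', D', hreach, hres, hrep, hL', hle⟩ :=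
        h.exists_recolor hχ hac hT hCD hz (mem_edgesAt.2 ⟨hze, hDe⟩) hTe
      exact ⟨n, C', D', hreach, hres, hrep, hL' L ha hc hL, by omega, by omega⟩
    · -- A flip with the color of `e` first makes `e` one of the repeated edges.
      have hdc : D e ≠ c := fun hDc =>
        Finset.notMem_empty e (hzc ▸ mem_edgesAt.2 ⟨hze, hDc⟩)
      have hd : D e ∈ L := (hL.mem_iff e).2 (hTe ▸ hc)
      obtain ⟨C₁, hC₁, S, hres, hrep, hcard, hsub, hdef⟩ :=
        hCD.exists_move_third_color hχ hac h hDe hdc hz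
      have hed : e ∈ edgesAt D z (D e) := mem_edgesAt.2 ⟨hze, rfl⟩
      have hz₁ : (edgesAt (BipartiteEdgeColoring.flip D a (D e) S) z a).card = 2 := by
        have h₁ := Finset.card_pos.2 ⟨e, hed⟩
        have h₂ := hrep.card_le_two z
        omega
      obtain ⟨n, C', D', hreach, hres', hrep', hL', hle⟩ :=
        hrep.exists_recolor hχ hac hT hres hz₁ (hsub hed) hTe
      have hsub' : deficient (BipartiteEdgeColoring.flip D a (D e) S) ⊆ deficient D := by
        intro v hv
        have hv' := hrep.mem_deficient_iff.1 hv
        by_cases hvz : v = z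
        · exact h.mem_deficient_iff.2 (hvz ▸ hz)
        · exact h.mem_deficient_iff.2 (hdef v hvz hv')
      have hle' := hflip hdc hrep 0 (Finset.card_le_card hsub')
      exact ⟨n + 1, C', D', .step hC₁ hres.isProper hreach, hres', hrep',
        hL' L ha hc (hL.flip ha hd S), by omega, by omega⟩

end Progress

section Completion

variable {V : Type*} [Fintype V] {G : SimpleGraph V} {k : ℕ}
  {C D T : G.EdgeLabeling (Fin k)} {χ : V → Bool} {a b c d : Fin k} {L : Finset (Fin k)}

/-! ### Completing one color class -/

/-- Changing the color of an edge at one end of which the new color is already present gives a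
labeling hidden behind the original coloring: the edge is a sub-path with an end that is not an
end vertex. -/
lemma IsProper.resolves_flip_singleton (hac : a ≠ c) (hC : IsProper C) {e : G.edgeSet}
    (he : C e = c) (h : ¬ IsProper (flip C a c {e})) : Resolves a c C (flip C a c {e}) := by
  refine ⟨hC, mem_support_flipSubpaths_of_mem ?_, fun h' => absurd h' h⟩
  have hC' := isProper_iff_card_edgesAt_le_one.1 hC
  have key := card_edgesAt_flip_singleton hac.symm he
  rw [flip_colors_comm] at key
  -- An end of the edge with two edges of color `a` after the flip is not an end vertex.
  obtain ⟨v, hv, hv'⟩ : ∃ v ∈ (e : Sym2 V), ¬ IsEndVertex C a c v := by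
    by_contra hne
    push Not at hne
    refine h (isProper_iff_card_edgesAt_le_one.2 fun v x => ?_)
    by_cases hv : v ∈ (e : Sym2 V)
    · have h₁ := (isEndVertex_iff hac).1 (hne v hv)
      have h₂ := Finset.card_pos.2 ⟨e, mem_edgesAt.2 ⟨hv, he⟩⟩
      have h₃ := key v
      rw [if_pos hv] at h₃
      by_cases hxa : x = a
      · subst hxa
        omega
      by_cases hxc : x = c
      · subst hxc
        omega
      · rw [edgesAt_flip_of_ne hxa hxc]
        exact hC' v x
    · have h₃ := key v
      rw [if_neg hv] at h₃
      by_cases hxa : x = a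
      · subst hxa
        exact h₃.2.trans_le (hC' v x)
      by_cases hxc : x = c
      · subst hxc
        have := hC' v x
        omega
      · rw [edgesAt_flip_of_ne hxa hxc]
        exact hC' v x
  obtain ⟨w, hvw, rfl⟩ := exists_adj_of_mem_edgesAt (mem_edgesAt.2 ⟨hv, he⟩)
  have hwalk : walkEdges (SimpleGraph.Walk.cons hvw .nil) = {⟨s(v, w), hvw⟩} := by
    ext f
    simp [mem_walkEdges, Subtype.ext_iff]
  refine mem_openSubpaths.2 ⟨v, w, ⟨.cons hvw .nil, ?_, by simp, ?_, hwalk⟩, Or.inl hv'⟩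
  · simpa using hvw.ne
  · refine ⟨by simp, ?_, ?_, by simp⟩
    · intro x hx
      simp only [colorsAlong, SimpleGraph.Walk.darts_cons, SimpleGraph.Walk.darts_nil,
        List.map_cons, List.map_nil, List.mem_singleton] at hx
      exact Or.inr (hx.trans he)
    · simp [colorsAlong]

lemma IsProper.card_deficient (hC : IsProper C) : (deficient C).card = 0 := by
  rw [hC.deficient_eq_empty, Finset.card_empty]

lemma IsProper.excess_le (hC : IsProper C) :
    excess C T c ≤ (Finset.univ.filter fun e => T e = c).card +
      2 * (Finset.univ.filter fun e => C e = c).card := by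
  have h₁ : (Finset.univ.filter fun e => T e = c ∧ C e ≠ c).card ≤
      (Finset.univ.filter fun e => T e = c).card :=
    Finset.card_le_card (Finset.monotone_filter_right _ fun _ _ h => h.1)
  have h₂ : (Finset.univ.filter fun e => C e = c ∧ T e ≠ c).card ≤
      (Finset.univ.filter fun e => C e = c).card :=
    Finset.card_le_card (Finset.monotone_filter_right _ fun _ _ h => h.1)
  rw [excess, hC.card_deficient]
  omega

/-- If an edge `e` of color `c` should have another color, then its color is changed; the two
possibly deficient ends of `e` are paid for by the decrease of the surplus of color `c`. -/
lemma IsProper.exists_flip_surplus (hχ : ∀ u v, G.Adj u v → χ u ≠ χ v) (hC : IsProper C)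
    {e : G.edgeSet} (he : C e = c) (hac : a ≠ c) (hT : T e = a) :
    OnlyRepeats (flip C a c {e}) χ a c ∧
      (deficient (flip C a c {e})).card ≤ 2 ∧
      excess (flip C a c {e}) T c + 2 = excess C T c + (deficient (flip C a c {e})).card := by
  have hC' := isProper_iff_card_edgesAt_le_one.1 hC
  have key := card_edgesAt_flip_singleton hac.symm he
  rw [flip_colors_comm] at key
  have hpos : ∀ v ∈ (e : Sym2 V), 0 < (edgesAt C v c).card := fun v hv =>
    Finset.card_pos.2 ⟨e, mem_edgesAt.2 ⟨hv, he⟩⟩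
  set D := flip C a c {e} with hD
  have hDe : D e = a := by
    rw [hD, flip_apply_of_mem _ _ _ _ (Finset.mem_singleton_self e), he, Equiv.swap_apply_right]
  have hDf : ∀ f, f ≠ e → D f = C f := fun f hf =>
    flip_apply_of_notMem _ _ _ _ (by simpa using hf)
  have hends : ∀ v, (edgesAt D v a).card = 2 → v ∈ (e : Sym2 V) := by
    intro v hv
    by_contra hve
    have h₁ := key v
    have h₂ := hC' v a
    rw [if_neg hve] at h₁
    omega
  have hrep : OnlyRepeats D χ a c := by
    refine ⟨fun v x hx => ?_, fun v => ?_, fun v hv => ?_, fun v w hv hw hvw => ?_⟩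
    · by_cases hxc : x = c
      · subst hxc
        have h₁ := key v
        have h₂ := hC' v x
        omega
      · rw [hD, edgesAt_flip_of_ne hx hxc]
        exact hC' v x
    · have h₁ := key v
      have h₂ := hC' v a
      split_ifs at h₁ <;> omega
    · have h₁ := key v
      have h₂ := hC' v c
      rw [if_pos (hends v hv)] at h₁
      omega
    · obtain ⟨u, huv, rfl⟩ := exists_adj_of_mem_edgesAt (mem_edgesAt.2 ⟨hends v hv, he⟩)
      rcases Sym2.mem_iff.1 (hends w hw) with rfl | rfl
      · rfl
      · exact absurd hvw (hχ _ _ huv)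
  refine ⟨hrep, ?_, ?_⟩
  · obtain ⟨⟨u, w⟩, huw⟩ := e
    refine (Finset.card_le_card (t := {u, w}) fun v hv => ?_).trans Finset.card_le_two
    simpa using Sym2.mem_iff.1 (hends v (hrep.mem_deficient_iff.1 hv))
  · have h₁ : (Finset.univ.filter fun f => T f = c ∧ D f ≠ c) =
        (Finset.univ.filter fun f => T f = c ∧ C f ≠ c) := by
      ext f
      by_cases hf : f = e
      · simp [hf, hT, hac]
      · simp [hDf f hf]
    have h₂ : (Finset.univ.filter fun f => C f = c ∧ T f ≠ c).card =
        (Finset.univ.filter fun f => D f = c ∧ T f ≠ c).card + 1 := by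
      have : (Finset.univ.filter fun f => C f = c ∧ T f ≠ c) =
          insert e (Finset.univ.filter fun f => D f = c ∧ T f ≠ c) := by
        ext f
        by_cases hf : f = e
        · simp [hf, hT, hac, he]
        · simp [hf, hDf f hf]
      rw [this, Finset.card_insert_of_notMem (by simp [hDe, hac])]
    rw [excess, excess, hC.card_deficient, h₁]
    omega

/-- If every edge of color `c` should have color `c`, then an edge with another color that should
have color `c` can be given this color right away. -/
lemma IsProper.exists_flip_missing (hC : IsProper C) (hT : IsProper T)
    (hle : ∀ f, C f = c → T f = c) {e : G.edgeSet} (he : T e = c) (hCe : C e ≠ c) :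
    IsProper (flip C (C e) c {e}) ∧ excess (flip C (C e) c {e}) T c + 1 = excess C T c := by
  have hC' := isProper_iff_card_edgesAt_le_one.1 hC
  have key := card_edgesAt_flip_singleton (D := C) hCe rfl
  set D := flip C (C e) c {e} with hD
  have hDe : D e = c := by
    rw [hD, flip_apply_of_mem _ _ _ _ (Finset.mem_singleton_self e), Equiv.swap_apply_left]
  have hDf : ∀ f, f ≠ e → D f = C f := fun f hf =>
    flip_apply_of_notMem _ _ _ _ (by simpa using hf)
  have hDp : IsProper D := by
    refine isProper_iff_card_edgesAt_le_one.2 fun v x => ?_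
    have h₁ := key v
    by_cases hxc : x = c
    · subst hxc
      by_cases hv : v ∈ (e : Sym2 V)
      · have : (edgesAt C v x).card = 0 := by
          refine Finset.card_eq_zero.2 (Finset.eq_empty_of_forall_notMem fun f hf => hCe ?_)
          obtain ⟨hvf, hf⟩ := mem_edgesAt.1 hf
          rw [hT.eq_of_mem hv hvf (he.trans (hle f hf).symm), hf]
        rw [if_pos hv] at h₁
        omega
      · rw [if_neg hv] at h₁
        exact h₁.2.trans_le (hC' v x)
    by_cases hxa : x = C e
    · rw [hxa]
      have := hC' v (C e)
      omega
    · rw [hD, edgesAt_flip_of_ne hxa hxc]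
      exact hC' v x
  refine ⟨hDp, ?_⟩
  have h₁ : (Finset.univ.filter fun f => D f = c ∧ T f ≠ c) =
      (Finset.univ.filter fun f => C f = c ∧ T f ≠ c) := by
    ext f
    by_cases hf : f = e
    · simp [hf, he]
    · simp [hDf f hf]
  have h₂ : (Finset.univ.filter fun f => T f = c ∧ C f ≠ c).card =
      (Finset.univ.filter fun f => T f = c ∧ D f ≠ c).card + 1 := by
    have : (Finset.univ.filter fun f => T f = c ∧ C f ≠ c) =
        insert e (Finset.univ.filter fun f => T f = c ∧ D f ≠ c) := by
      ext f
      by_cases hf : f = e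
      · simp [hf, he, hCe]
      · simp [hf, hDf f hf]
    rw [this, Finset.card_insert_of_notMem (by simp [hDe])]
  rw [excess, excess, hC.card_deficient, hDp.card_deficient, h₁]
  omega

/-- The color class `c` can be made equal to the one of the target `T`, without changing the
colors outside `L`, in a number of steps bounded by the excess.  The two parts, for an edge coloring
and for a hidden labeling with one repeated color, are proved by a simultaneous induction. -/
lemma exists_complete_color (hχ : ∀ u v, G.Adj u v → χ u ≠ χ v) (hT : IsProper T) (hc : c ∈ L)
    (N : ℕ) :
    (∀ C, IsProper C → AgreeOutside L C T → excess C T c ≤ N →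
      ∃ n ≤ N, ∃ C', ReachesIn n C C' ∧ IsProper C' ∧ AgreeOutside L C' T ∧
        ∀ e, C' e = c ↔ T e = c) ∧
    ∀ a C D, a ≠ c → a ∈ L → OnlyRepeats D χ a c → Resolves a c C D → AgreeOutside L D T →
      excess D T c ≤ N →
      ∃ n ≤ N, ∃ C', ReachesIn n C C' ∧ IsProper C' ∧ AgreeOutside L C' T ∧
        ∀ e, C' e = c ↔ T e = c := by
  induction N using Nat.strong_induction_on with
  | _ N ih =>
    have hprogress : ∀ a C D, a ≠ c → a ∈ L → OnlyRepeats D χ a c → Resolves a c C D →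
        AgreeOutside L D T → excess D T c ≤ N → ∀ z, (edgesAt D z a).card = 2 →
        ∃ n ≤ N, ∃ C', ReachesIn n C C' ∧ IsProper C' ∧ AgreeOutside L C' T ∧
          ∀ e, C' e = c ↔ T e = c := by
      intro a C D hac ha h hCD hL hN z hz
      obtain ⟨m, C₁, D₁, hreach, hres, hrep, hL₁, hle, hlt⟩ :=
        h.exists_progress hχ hac hT hCD hL ha hc hz
      obtain ⟨n, hn, C', hreach', h'⟩ :=
        (ih (excess D₁ T c) (by omega)).2 a C₁ D₁ hac ha hrep hres hL₁ le_rfl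
      exact ⟨m + n, by omega, C', hreach.trans hreach', h'⟩
    have hproper : ∀ C, IsProper C → AgreeOutside L C T → excess C T c ≤ N →
        ∃ n ≤ N, ∃ C', ReachesIn n C C' ∧ IsProper C' ∧ AgreeOutside L C' T ∧
          ∀ e, C' e = c ↔ T e = c := by
      intro C hC hL hN
      by_cases hsurplus : ∃ e, C e = c ∧ T e ≠ c
      · -- An edge of color `c` that should have another color is given that color.  Without a
        -- conflict this is a step of the chain; with a conflict the new labeling is already hidden
        -- behind `C`, and no step is made.
        obtain ⟨e, he, hTe⟩ := hsurplus
        have ha : T e ∈ L := (hL.mem_iff e).1 (he ▸ hc)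
        obtain ⟨hrep, hdef, hex⟩ := hC.exists_flip_surplus hχ he hTe rfl
        by_cases hp : IsProper (flip C (T e) c {e})
        · rw [hp.card_deficient] at hex
          obtain ⟨n, hn, C', hreach, h'⟩ := (ih (excess (flip C (T e) c {e}) T c) (by omega)).1
            _ hp (hL.flip ha hc _) le_rfl
          exact ⟨n + 1, by omega, C', .step
            (hC.mem_support_move_flip_singleton hTe (Or.inr he) hp) hp hreach, h'⟩
        · obtain ⟨z, hz⟩ : ∃ z, (edgesAt (flip C (T e) c {e}) z (T e)).card = 2 := by
            by_contra hne
            push Not at hne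
            exact hp (hrep.isProper hne)
          exact hprogress (T e) C _ hTe ha hrep (hC.resolves_flip_singleton hTe he hp)
            (hL.flip ha hc _) (by omega) z hz
      · push Not at hsurplus
        by_cases hmissing : ∃ e, T e = c ∧ C e ≠ c
        · obtain ⟨e, he, hCe⟩ := hmissing
          obtain ⟨hp, hex⟩ := hC.exists_flip_missing hT hsurplus he hCe
          have ha : C e ∈ L := (hL.mem_iff e).2 (he ▸ hc)
          obtain ⟨n, hn, C', hreach, h'⟩ := (ih (excess (flip C (C e) c {e}) T c) (by omega)).1
            _ hp (hL.flip ha hc _) le_rfl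
          exact ⟨n + 1, by omega, C', .step
            (hC.mem_support_move_flip_singleton hCe (Or.inl rfl) hp) hp hreach, h'⟩
        · push Not at hmissing
          exact ⟨0, Nat.zero_le _, C, .refl C, hC, hL, fun e => ⟨hsurplus e, hmissing e⟩⟩
    refine ⟨hproper, fun a C D hac ha h hCD hL hN => ?_⟩
    by_cases hz : ∃ z, (edgesAt D z a).card = 2
    · obtain ⟨z, hz⟩ := hz
      exact hprogress a C D hac ha h hCD hL hN z hz
    · push Not at hz
      obtain rfl := hCD.eq_of_isProper (h.isProper hz)
      exact hproper C hCD.isProper hL hN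

/-! ### Completing all color classes -/

/-- In each round a color is treated whose class is at most as large in the current coloring as in
the target, so that it takes at most three steps for each edge of this class of the target. -/
lemma IsProper.exists_reachesIn (hχ : ∀ u v, G.Adj u v → χ u ≠ χ v) (hT : IsProper T)
    (hC : IsProper C) (hL : AgreeOutside L C T) :
    ∃ n ≤ 3 * (Finset.univ.filter fun e => T e ∈ L).card, ReachesIn n C T := by
  induction hm : L.card generalizing L C with
  | zero =>
    obtain rfl := Finset.card_eq_zero.1 hm
    obtain rfl : C = T := funext fun e => hL e (Or.inl (Finset.notMem_empty _))
    exact ⟨0, Nat.zero_le _, .refl C⟩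
  | succ m ih =>
    have hsum : ∀ X : G.EdgeLabeling (Fin k), (∀ e, X e ∈ L ↔ T e ∈ L) →
        ∑ x ∈ L, (Finset.univ.filter fun e => X e = x).card =
          (Finset.univ.filter fun e => T e ∈ L).card := by
      intro X hX
      rw [Finset.card_eq_sum_card_fiberwise (f := X) (t := L)
        fun e he => (hX e).2 (Finset.mem_filter.1 he).2]
      refine Finset.sum_congr rfl fun x hx => congrArg Finset.card ?_
      ext e
      simp only [Finset.mem_filter, Finset.mem_univ, true_and]
      exact ⟨fun h => ⟨(hX e).1 (h ▸ hx), h⟩, fun h => h.2⟩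
    obtain ⟨c, hc, hle⟩ := Finset.exists_le_of_sum_le (Finset.card_pos.1 (by omega))
      ((hsum C hL.mem_iff).trans (hsum T fun _ => Iff.rfl).symm).le
    obtain ⟨n, hn, C', hreach, hC', hL', hcls⟩ :=
      (exists_complete_color hχ hT hc _).1 C hC hL (hC.excess_le (T := T) (c := c))
    have hL'' : AgreeOutside (L.erase c) C' T := by
      intro e he
      by_cases hec : C' e = c
      · rw [hec, (hcls e).1 hec]
      · have hTc : T e ≠ c := fun h => hec ((hcls e).2 h)
        exact hL' e (he.imp (fun h h' => h (Finset.mem_erase.2 ⟨hec, h'⟩))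
          fun h h' => h (Finset.mem_erase.2 ⟨hTc, h'⟩))
    obtain ⟨n', hn', hreach'⟩ := ih hC' hL'' (by rw [Finset.card_erase_of_mem hc]; omega)
    refine ⟨n + n', ?_, hreach.trans hreach'⟩
    have hsplit : (Finset.univ.filter fun e => T e ∈ L).card =
        (Finset.univ.filter fun e => T e = c).card +
          (Finset.univ.filter fun e => T e ∈ L.erase c).card := by
      rw [← Finset.card_union_of_disjoint]
      · congr 1
        ext e
        by_cases hec : T e = c <;> simp [hec, hc]
      · rw [Finset.disjoint_filter]
        intro e _ h h'
        exact Finset.notMem_erase c L (h ▸ h')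
    omega

end Completion

/-! ### Powers of the transition matrix -/

section TransitionMatrix

variable {V : Type*} [Fintype V] {G : SimpleGraph V} {k : ℕ}

lemma transitionMatrix_nonneg (C D : EdgeColoring G k) : 0 ≤ transitionMatrix G k C D :=
  ENNReal.toReal_nonneg

lemma transitionMatrix_pos {C D : EdgeColoring G k} (h : D.1 ∈ (move C.1).support) :
    0 < transitionMatrix G k C D := by
  refine ENNReal.toReal_pos ?_ (PMF.apply_ne_top _ _)
  rw [← PMF.mem_support_iff, step, PMF.mem_support_map_iff]
  exact ⟨D.1, h, dif_pos D.2⟩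

lemma transitionMatrix_self_pos (C : EdgeColoring G k) : 0 < transitionMatrix G k C C :=
  transitionMatrix_pos (mem_support_coin_left (by simp))

lemma transitionMatrix_pow_nonneg [DecidableEq (EdgeColoring G k)] (n : ℕ)
    (C D : EdgeColoring G k) : 0 ≤ (transitionMatrix G k ^ n) C D := by
  induction n generalizing C with
  | zero =>
    rw [pow_zero, Matrix.one_apply]
    split_ifs <;> norm_num
  | succ n ih =>
    rw [pow_succ', Matrix.mul_apply]
    exact Finset.sum_nonneg fun E _ => mul_nonneg (transitionMatrix_nonneg C E) (ih E)

lemma transitionMatrix_pow_succ_pos [DecidableEq (EdgeColoring G k)] {n : ℕ}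
    {C D E : EdgeColoring G k} (hCD : 0 < transitionMatrix G k C D)
    (hDE : 0 < (transitionMatrix G k ^ n) D E) : 0 < (transitionMatrix G k ^ (n + 1)) C E := by
  rw [pow_succ', Matrix.mul_apply]
  exact Finset.sum_pos' (fun F _ => mul_nonneg (transitionMatrix_nonneg C F)
    (transitionMatrix_pow_nonneg n F E)) ⟨D, Finset.mem_univ D, mul_pos hCD hDE⟩

lemma ReachesIn.transitionMatrix_pow_pos [DecidableEq (EdgeColoring G k)] {n : ℕ}
    {C D : G.EdgeLabeling (Fin k)} (h : ReachesIn n C D) (hC : IsProper C) (hD : IsProper D) :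
    0 < (transitionMatrix G k ^ n) ⟨C, hC⟩ ⟨D, hD⟩ := by
  induction h with
  | refl => simp
  | step hmem hp _ ih =>
    exact transitionMatrix_pow_succ_pos (D := ⟨_, hp⟩) (transitionMatrix_pos hmem) (ih hp hD)

/-- Any two edge colorings of a bipartite graph are connected by at most three steps per edge. -/
theorem exists_transitionMatrix_pow_pos (hG : G.IsBipartite) [Fintype G.edgeSet]
    [DecidableEq (EdgeColoring G k)] (C₁ C₂ : EdgeColoring G k) :
    ∃ n ≤ 3 * G.edgeFinset.card, 0 < (transitionMatrix G k ^ n) C₁ C₂ := by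
  obtain ⟨χ⟩ := hG
  have hχ : ∀ u v, G.Adj u v → decide (χ u = 0) ≠ decide (χ v = 0) := by
    intro u v huv heq
    have := χ.valid huv
    rw [decide_eq_decide] at heq
    omega
  obtain ⟨n, hn, hreach⟩ := C₂.2.exists_reachesIn (L := Finset.univ) hχ C₁.2
    (fun e he => absurd he (by simp))
  refine ⟨n, hn.trans_eq ?_, hreach.transitionMatrix_pow_pos C₁.2 C₂.2⟩
  rw [SimpleGraph.edgeFinset_card]
  simp only [Finset.mem_univ, Finset.filter_true, Finset.card_univ]
  congr!

end TransitionMatrix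

end BipartiteEdgeColoring

end

theorem mainTheorem1 {V : Type*} [Fintype V] [DecidableEq V] (G : SimpleGraph V)
    [DecidableRel G.Adj] (hG : G.IsBipartite) (k : ℕ) (hk : G.maxDegree ≤ k)
    [DecidableEq (BipartiteEdgeColoring.EdgeColoring G k)] :
    (∀ C₁ C₂ : BipartiteEdgeColoring.EdgeColoring G k,
      ∃ n ≤ 6 * G.edgeFinset.card,
        0 < (BipartiteEdgeColoring.transitionMatrix G k ^ n) C₁ C₂) ∧
    (BipartiteEdgeColoring.transitionMatrix G k).IsIrreducible ∧
    BipartiteEdgeColoring.diameter (BipartiteEdgeColoring.transitionMatrix G k) ≤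
      ((6 * G.edgeFinset.card : ℕ) : ℕ∞) := by
  refine ⟨fun C₁ C₂ => ?_, ?_, ?_⟩
  · obtain ⟨n, hn, hpos⟩ := BipartiteEdgeColoring.exists_transitionMatrix_pow_pos hG C₁ C₂
    exact ⟨n, by omega, hpos⟩
  · rw [Matrix.isIrreducible_iff_exists_pow_pos BipartiteEdgeColoring.transitionMatrix_nonneg]
    intro C₁ C₂
    obtain ⟨n, -, hpos⟩ := BipartiteEdgeColoring.exists_transitionMatrix_pow_pos hG C₁ C₂
    -- A step that changes nothing makes the number of steps positive.
    exact ⟨n + 1, Nat.succ_pos n, BipartiteEdgeColoring.transitionMatrix_pow_succ_pos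
      (BipartiteEdgeColoring.transitionMatrix_self_pos C₁) hpos⟩
  · refine iSup_le fun C₁ => iSup_le fun C₂ => ?_
    -- The definition of the distance uses classical decidability of equality.
    classical
    obtain ⟨n, hn, hpos⟩ := BipartiteEdgeColoring.exists_transitionMatrix_pow_pos hG C₁ C₂
    refine (iInf₂_le n ?_).trans (Nat.cast_le.2 (show n ≤ 6 * G.edgeFinset.card by omega))
    convert hpos
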